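/- Let $\mathcal{L}$ be a countable first-order signature with a fixed injective numbering of its symbols; formulas are coded by natural numbers accordingly. Structures are nonempty. A \emph{separation rule} for $\mathcal{L}$ is either an $\mathcal{L}$-sentence (order zero), or a monadic second-order sentence $$\forall x_1\ldots x_N\Big(\mu(\vec x)\rightarrow \exists C_1\ldots C_K\big(\eta(\vec x)\wedge \bigwedge_{i\in I}\forall y_1\ldots y_{M_i}(\gamma_i(\vec y)\rightarrow\psi_i(\vec y))\big)\Big)$$ of order $K\ge 1$, where $C_1,\ldots,C_K$ are unary predicate symbols not in $\mathcal{L}$, $\mu$ and all $\gamma_i$ are $\mathcal{L}$-formulas, $\eta$ and all $\psi_i$ are quantifier-free formulas over $\mathcal{L}\cup\{C_1,\ldots,C_K\}$, and the index set $I$ may be infinite, or empty (in which case the conjunction is $\top$). A set $\Sigma$ of separation rules is \emph{essentially recursively enumerable} if $\Sigma=\{\sigma_n:n\in\omega\}$ for an effective listing of r.e. separation rules: one algorithm computes from $n$ the finite part of $\sigma_n$ (the sentence $\sigma_n$ itself if its order is zero, and $N,K,\mu,\eta$ otherwise), and one algorithm enumerates, for all $n$, the conjuncts $\forall\vec y(\gamma_i\rightarrow\psi_i)$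 of $\sigma_n$. Let $\mathcal{A}$ be an elementary class of $\mathcal{L}$-structures, let $\Sigma$ be an essentially recursively enumerable set of separation rules, and let $\mathcal{B}=\{A\in\mathcal{A}: A\models\sigma\text{ for all }\sigma\in\Sigma\}$. Then: (1) $\mathcal{B}$ has a recursive axiomatisation relative to $\mathcal{A}$, i.e. there is a recursive set $T$ of first-order $\mathcal{L}$-sentences with $\mathcal{B}=\{A\in\mathcal{A}:A\models T\}$. (2) Suppose that for every $\sigma\in\Sigma$ of positive order the prenex normal form of $\mu$ contains no universal quantifiers and the prenex normal form of every $\gamma_i$ contains no universal quantifiers, and that the prenex normal form of every $\sigma\in\Sigma$ of order zero is universal. Then there is such a recursive set $T$ that consists of universal sentences. -/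

import Mathlib

open FirstOrder FirstOrder.Language

universe u v w

namespace Separation

/-! ### Signatures with extra unary predicate symbols -/

/-- The symbols `C₁, …, C_K`, each of arity one. -/
inductive PredSymbol (K : ℕ) : ℕ → Type
  | C (k : Fin K) : PredSymbol K 1

/-- The signature that consists of `K` unary predicate symbols and nothing else. -/
def predLang (K : ℕ) : FirstOrder.Language.{0, 0} := ⟨fun _ => Empty, PredSymbol K⟩

/-- The signature `L⁺ = L ∪ {C₁, …, C_K}`. -/
abbrev plusLang (L : FirstOrder.Language.{u, v}) (K : ℕ) : FirstOrder.Language.{u, v} := L.sum (predLang K)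

/-- The interpretation of `C₁, …, C_K` in `A` by given subsets of `A`. -/
abbrev predStructure {K : ℕ} {A : Type w} (C : Fin K → Set A) : (predLang K).Structure A where
  funMap f _ := f.elim
  RelMap
    | .C k, xs => xs 0 ∈ C k

/-- Truth of an `L⁺`-formula in an `L`-structure, where `C_k` is interpreted as the set `C k`. -/
def RealizeWith {L : FirstOrder.Language.{u, v}} {K : ℕ} {α : Type} {A : Type w} [L.Structure A]
    (φ : (plusLang L K).Formula α) (C : Fin K → Set A) (x : α → A) : Prop :=
  letI : (predLang K).Structure A := predStructure C
  φ.Realize x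

/-! ### Separation rules and separation schemes -/

/-- A conjunct `∀ y₁ … y_M (γ(y) → ψ(y))` of a closure rule for `C₁, …, C_K`: here `γ` is an
`L`-formula and `ψ` is a quantifier-free `L⁺`-formula. -/
structure ClosureClause (L : FirstOrder.Language.{u, v}) (K : ℕ) where
  M : ℕ
  γ : L.Formula (Fin M)
  ψ : (plusLang L K).Formula (Fin M)
  ψ_isQF : BoundedFormula.IsQF ψ

/-- A separation rule: either an `L`-sentence (order zero), or
`∀ x₁ … x_N (μ(x) → ∃ C₁ … C_K (η(x) ∧ ⋀ τ))`, of order `K ≥ 1`, where `μ` is an `L`-formula, `η` is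
a quantifier-free `L⁺`-formula, and `τ` is a set of conjuncts of any size. If `τ` is empty then
`⋀ τ` is the tautology `⊤`. -/
inductive SeparationRule (L : FirstOrder.Language.{u, v}) : Type (max u v)
  | zero (φ : L.Sentence) : SeparationRule L
  | pos (N K : ℕ) (one_le : 1 ≤ K) (μ : L.Formula (Fin N)) (η : (plusLang L K).Formula (Fin N))
      (η_isQF : BoundedFormula.IsQF η) (τ : Set (ClosureClause L K)) : SeparationRule L

/-- Truth of a conjunct of a closure rule, with `C_k` interpreted as `C k`. -/
def ClosureClause.Holds {L : FirstOrder.Language.{u, v}} {K : ℕ} (c : ClosureClause L K)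
    {A : Type w} [L.Structure A] (C : Fin K → Set A) : Prop :=
  ∀ y : Fin c.M → A, c.γ.Realize y → RealizeWith c.ψ C y

/-- Truth of a separation rule: the standard semantics of monadic second-order logic. -/
def SeparationRule.Holds {L : FirstOrder.Language.{u, v}} (A : Type w) [L.Structure A] :
    SeparationRule L → Prop
  | .zero φ => A ⊨ φ
  | .pos N K _ μ η _ τ =>
      ∀ x : Fin N → A, μ.Realize x →
        ∃ C : Fin K → Set A, RealizeWith η C x ∧ ∀ c ∈ τ, c.Holds C

/-! ### Classes of structures -/

/-- A class of (nonempty) `L`-structures. The models of the empty theory are all such structures. -/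
abbrev StructureClass (L : FirstOrder.Language.{u, v}) := Set (Theory.ModelType.{u, v, w} (∅ : L.Theory))

/-- An elementary class: the class of all models of some first-order theory. -/
def IsElementary {L : FirstOrder.Language.{u, v}} (𝒜 : StructureClass.{u, v, w} L) : Prop :=
  ∃ T : L.Theory, 𝒜 = {A : Theory.ModelType.{u, v, w} (∅ : L.Theory) | A ⊨ T}

/-- `T` axiomatises `ℬ` relative to `𝒜`. -/
def AxiomatisesRel {L : FirstOrder.Language.{u, v}} (T : L.Theory) (ℬ 𝒜 : StructureClass.{u, v, w} L) : Prop :=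
  ℬ = {A | A ∈ 𝒜 ∧ A ⊨ T}

/-- `ℬ` is the separation subclass of `𝒜` that is defined by the separation scheme `S`. -/
def IsSeparationSubclass {L : FirstOrder.Language.{u, v}} (S : Set (SeparationRule L))
    (ℬ 𝒜 : StructureClass.{u, v, w} L) : Prop :=
  ℬ = {A | A ∈ 𝒜 ∧ ∀ σ ∈ S, σ.Holds A}

/-! ### Gödel numbers

All codes are relative to a numbering of the symbols of `L`, which is given by the `Encodable`
instances on `Σ n, L.Functions n` and `Σ n, L.Relations n`. -/

/-- The code of a term. -/
def termCode {L : FirstOrder.Language.{u, v}} [Encodable (Σ n, L.Functions n)] {α : Type} [Encodable α] :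
    L.Term α → ℕ
  | .var a => Nat.pair 0 (Encodable.encode a)
  | @Term.func _ _ n f ts => Nat.pair 1 (Nat.pair (Encodable.encode (⟨n, f⟩ : Σ n, L.Functions n))
      (Encodable.encode (List.ofFn fun i => termCode (ts i))))

/-- The code of a formula. -/
def formulaCode {L : FirstOrder.Language.{u, v}} [Encodable (Σ n, L.Functions n)]
    [Encodable (Σ n, L.Relations n)] {α : Type} [Encodable α] :
    ∀ {n : ℕ}, L.BoundedFormula α n → ℕ
  | _, .falsum => Nat.pair 0 0
  | _, .equal t₁ t₂ => Nat.pair 1 (Nat.pair (termCode t₁) (termCode t₂))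
  | _, @BoundedFormula.rel _ _ _ l R ts =>
      Nat.pair 2 (Nat.pair (Encodable.encode (⟨l, R⟩ : Σ n, L.Relations n))
        (Encodable.encode (List.ofFn fun i => termCode (ts i))))
  | _, .imp φ ψ => Nat.pair 3 (Nat.pair (formulaCode φ) (formulaCode ψ))
  | _, .all φ => Nat.pair 4 (formulaCode φ)

theorem termCode_injective {L : FirstOrder.Language.{u, v}} [Encodable (Σ n, L.Functions n)] {α : Type}
    [Encodable α] : Function.Injective (termCode : L.Term α → ℕ) := by
  intro s
  induction s with
  | var a =>
    intro t h
    cases t with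
    | var b => simpa [termCode] using h
    | func g us => simp [termCode] at h
  | @func n f ts ih =>
    intro t h
    cases t with
    | var b => simp [termCode] at h
    | @func m g us =>
      simp only [termCode, Nat.pair_eq_pair, Encodable.encode_inj, true_and] at h
      obtain ⟨h1, h2⟩ := h
      obtain ⟨rfl, h1⟩ := Sigma.mk.inj_iff.1 h1
      obtain rfl := eq_of_heq h1
      have h3 := List.ofFn_injective h2
      congr 1
      funext i
      exact ih i (congrFun h3 i)

theorem formulaCode_injective {L : FirstOrder.Language.{u, v}} [Encodable (Σ n, L.Functions n)]
    [Encodable (Σ n, L.Relations n)] {α : Type} [Encodable α] {n : ℕ} :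
    Function.Injective (formulaCode : L.BoundedFormula α n → ℕ) := by
  intro φ
  induction φ with
  | falsum => intro ψ h; cases ψ <;> simp [formulaCode] at h ⊢
  | equal t₁ t₂ =>
    intro ψ h
    cases ψ <;> simp [formulaCode] at h ⊢
    exact ⟨termCode_injective h.1, termCode_injective h.2⟩
  | @rel k l R ts =>
    intro ψ h
    cases ψ with
    | @rel _ m S us =>
      simp only [formulaCode, Nat.pair_eq_pair, Encodable.encode_inj, true_and] at h
      obtain ⟨h1, h2⟩ := h
      obtain ⟨rfl, h1⟩ := Sigma.mk.inj_iff.1 h1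
      obtain rfl := eq_of_heq h1
      have h3 := List.ofFn_injective h2
      congr 1
      funext i
      exact termCode_injective (congrFun h3 i)
    | _ => simp [formulaCode] at h
  | imp _ _ ih1 ih2 =>
    intro ψ h
    cases ψ <;> simp [formulaCode] at h ⊢
    exact ⟨ih1 h.1, ih2 h.2⟩
  | all _ ih =>
    intro ψ h
    cases ψ <;> simp [formulaCode] at h ⊢
    exact ih h

/-- The numbering of the function symbols of `L⁺`: these are the function symbols of `L`. -/
instance plusFunctionsEncodable (L : FirstOrder.Language.{u, v}) [Encodable (Σ n, L.Functions n)] (K : ℕ) :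
    Encodable (Σ n, (plusLang L K).Functions n) :=
  Encodable.ofLeftInverse (α := Σ n, L.Functions n)
    (fun
      | ⟨n, .inl f⟩ => ⟨n, f⟩
      | ⟨_, .inr e⟩ => nomatch e)
    (fun f => ⟨f.1, .inl f.2⟩)
    (by rintro ⟨n, f | e⟩ <;> [rfl; exact nomatch e])

/-- The numbering of the relation symbols of `L⁺`: if `R` is a symbol of `L` with number `m`, then
it gets the number `2 * m`, and the symbol `C k` gets the number `2 * k + 1`. -/
instance plusRelationsEncodable (L : FirstOrder.Language.{u, v}) [Encodable (Σ n, L.Relations n)] (K : ℕ) :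
    Encodable (Σ n, (plusLang L K).Relations n) :=
  Encodable.ofLeftInverse (α := (Σ n, L.Relations n) ⊕ Fin K)
    (fun
      | ⟨n, .inl R⟩ => .inl ⟨n, R⟩
      | ⟨_, .inr (.C k)⟩ => .inr k)
    (fun
      | .inl R => ⟨R.1, .inl R.2⟩
      | .inr k => ⟨1, .inr (.C k)⟩)
    (by
      rintro ⟨n, R | k⟩
      · rfl
      · cases (show PredSymbol K n from k); rfl)

/-- The code of a conjunct of a closure rule. -/
def ClosureClause.code {L : FirstOrder.Language.{u, v}} [Encodable (Σ n, L.Functions n)]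
    [Encodable (Σ n, L.Relations n)] {K : ℕ} (c : ClosureClause L K) : ℕ :=
  Nat.pair c.M (Nat.pair (formulaCode c.γ) (formulaCode c.ψ))

/-- The code of the finite part of a separation rule: the whole rule if its order is zero, and
`N`, `K`, `μ` and `η` otherwise. -/
def SeparationRule.headCode {L : FirstOrder.Language.{u, v}} [Encodable (Σ n, L.Functions n)]
    [Encodable (Σ n, L.Relations n)] : SeparationRule L → ℕ
  | .zero φ => Nat.pair 0 (formulaCode φ)
  | .pos N K _ μ η _ _ =>
      Nat.pair 1 (Nat.pair N (Nat.pair K (Nat.pair (formulaCode μ) (formulaCode η))))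

/-- The codes of the conjuncts of the closure rule of a separation rule. -/
def SeparationRule.clauseCodes {L : FirstOrder.Language.{u, v}} [Encodable (Σ n, L.Functions n)]
    [Encodable (Σ n, L.Relations n)] : SeparationRule L → Set ℕ
  | .zero _ => ∅
  | .pos _ _ _ _ _ _ τ => ClosureClause.code '' τ

/-- `S` is essentially recursively enumerable: `S = {σ₀, σ₁, …}`, where the `σₙ` are r.e. separation
rules that can be listed effectively. That is, one algorithm computes the finite part of `σₙ` from
`n`, and one algorithm lists, for every `n`, the conjuncts `τᵢ` of `σₙ`. -/
def EssentiallyRE {L : FirstOrder.Language.{u, v}} [Encodable (Σ n, L.Functions n)]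
    [Encodable (Σ n, L.Relations n)] (S : Set (SeparationRule L)) : Prop :=
  ∃ σ : ℕ → SeparationRule L, S = Set.range σ ∧
    Computable (fun n => (σ n).headCode) ∧
    REPred (fun p : ℕ × ℕ => p.2 ∈ (σ p.1).clauseCodes)

/-- A theory is recursive if the set of the codes of its sentences is decidable. -/
def IsRecursive {L : FirstOrder.Language.{u, v}} [Encodable (Σ n, L.Functions n)]
    [Encodable (Σ n, L.Relations n)] (T : L.Theory) : Prop :=
  ComputablePred (fun m : ℕ => ∃ φ ∈ T, formulaCode φ = m)

/-! ### Universal axiomatisations -/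

/-- For a rule of order zero: its prenex normal form is universal. For a rule of positive order: the
prenex normal forms of `μ` and of the premises `γ` of the conjuncts contain no universal
quantifiers. -/
def SeparationRule.MeetsUniversalCondition {L : FirstOrder.Language.{u, v}} : SeparationRule L → Prop
  | .zero φ => (BoundedFormula.toPrenex φ).IsUniversal
  | .pos _ _ _ μ _ _ τ =>
      (BoundedFormula.toPrenex μ).IsExistential ∧
        ∀ c ∈ τ, (BoundedFormula.toPrenex c.γ).IsExistential

/-- All sentences of the theory are universal. -/
def IsUniversalTheory {L : FirstOrder.Language.{u, v}} (T : L.Theory) : Prop :=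
  ∀ φ ∈ T, BoundedFormula.IsUniversal φ

end Separation

/-!
A separation rule asks for sets `C₁, …, C_K` that satisfy a family of quantifier-free conditions, one
for each instance `y` of a clause `γ → ψ` with `γ(y)` true. Each condition involves finitely many of
the truth values `a ∈ C_k` only, so it defines a closed set in the compact space `Fin K → A → Bool`,
and such `C` exist as soon as they exist for finitely many instances at a time
(`holds_pos_iff_models_ruleAxiom`). Whether they exist for finitely many given instances is a
first-order property of the tuples involved: a quantifier-free formula sees of `C` only which of its
atoms `C_k(t)` are true, so it suffices to try the finite sets of values of the terms `t` that occur,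
one for each set of atoms (`exists_realize_elimPred_iff`). The resulting sentences `ruleAxiom`,
together with the rules of order zero, form the theory `SchemeTheory S`, whose models are the
structures that satisfy all rules.

The axioms can be listed effectively: the syntactic operations used to build them are primitive
recursive on codes, by course-of-values recursion, and the clauses of a rule are enumerated by
running the given semi-decision procedure step by step (`exists_enumeration_schemeTheory`). No
decision procedure for well-formedness of codes is needed (the arity of a symbol need not be
computable from its number), because every code that occurs is obtained from codes of given formulas.
Craig's trick turns the listing into a recursive theory: if the `n`-th sentence is padded to a code
of size at least `n`, then membership can be decided by a bounded search (`isRecursive_range`).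

For the universal version, passing to the prenex normal form does not change the property that all
quantifiers `∀` occur positively, or that all occur negatively (`hasPolarity_toPrenex`). Under the
assumptions on `μ`, `γ` and the rules of order zero all quantifiers of the axioms occur positively,
and they can be pulled to the front one at a time by the operation `pull`. Pulling more often than necessary
adds dummy quantifiers, which serve as the padding in Craig's trick
(`exists_isRecursive_isUniversalTheory`).
-/

namespace Separation

/-! ### Polarity and prenex normal forms -/

section Polarity

variable {L : FirstOrder.Language.{u, v}} {α : Type} {β : Type}

/-- `HasPolarity true φ` says that every quantifier `∀` of `φ` occurs positively, so that `φ` is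
logically equivalent to a universal formula; `HasPolarity false φ` says that every one occurs
negatively, so that `φ` is equivalent to an existential formula. -/
def HasPolarity : Bool → ∀ {n : ℕ}, L.BoundedFormula α n → Prop
  | b, _, .imp φ ψ => HasPolarity (!b) φ ∧ HasPolarity b ψ
  | b, _, .all φ => b = true ∧ HasPolarity b φ
  | _, _, .falsum => True
  | _, _, .equal _ _ => True
  | _, _, .rel _ _ => True

/-- The number of quantifiers of a formula. -/
def numAll : ∀ {n : ℕ}, L.BoundedFormula α n → ℕ
  | _, .imp φ ψ => numAll φ + numAll ψ
  | _, .all φ => numAll φ + 1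
  | _, .falsum => 0
  | _, .equal _ _ => 0
  | _, .rel _ _ => 0

theorem hasPolarity_mapTermRel {g : ℕ → ℕ}
    (ft : ∀ n, L.Term (α ⊕ (Fin n)) → L.Term (β ⊕ (Fin (g n)))) (b : Bool)
    (h : ∀ n, L.BoundedFormula β (g (n + 1)) → L.BoundedFormula β (g n + 1))
    (hh : ∀ b n (φ : L.BoundedFormula β (g (n + 1))), HasPolarity b (h n φ) ↔ HasPolarity b φ)
    {n : ℕ} (φ : L.BoundedFormula α n) :
    HasPolarity b (φ.mapTermRel ft (fun _ => id) h) ↔ HasPolarity b φ := by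
  induction φ generalizing b with
  | falsum => simp [BoundedFormula.mapTermRel, HasPolarity]
  | equal => simp [BoundedFormula.mapTermRel, HasPolarity]
  | rel => simp [BoundedFormula.mapTermRel, HasPolarity]
  | imp _ _ ih1 ih2 => simp [BoundedFormula.mapTermRel, HasPolarity, ih1, ih2]
  | all _ ih => simp [BoundedFormula.mapTermRel, HasPolarity, ih, hh]

theorem numAll_mapTermRel {g : ℕ → ℕ}
    (ft : ∀ n, L.Term (α ⊕ (Fin n)) → L.Term (β ⊕ (Fin (g n))))
    (h : ∀ n, L.BoundedFormula β (g (n + 1)) → L.BoundedFormula β (g n + 1))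
    (hh : ∀ n (φ : L.BoundedFormula β (g (n + 1))), numAll (h n φ) = numAll φ)
    {n : ℕ} (φ : L.BoundedFormula α n) :
    numAll (φ.mapTermRel ft (fun _ => id) h) = numAll φ := by
  induction φ with
  | falsum => simp [BoundedFormula.mapTermRel, numAll]
  | equal => simp [BoundedFormula.mapTermRel, numAll]
  | rel => simp [BoundedFormula.mapTermRel, numAll]
  | imp _ _ ih1 ih2 => simp [BoundedFormula.mapTermRel, numAll, ih1, ih2]
  | all _ ih => simp [BoundedFormula.mapTermRel, numAll, ih, hh]

theorem hasPolarity_castLE {m n : ℕ} (h : m ≤ n) (b : Bool) (φ : L.BoundedFormula α m) :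
    HasPolarity b (φ.castLE h) ↔ HasPolarity b φ := by
  induction φ generalizing n b with
  | falsum => simp [HasPolarity]
  | equal => simp [HasPolarity]
  | rel => simp [HasPolarity]
  | imp _ _ ih1 ih2 => simp [HasPolarity, ih1, ih2]
  | all _ ih => simp [HasPolarity, ih]

theorem numAll_castLE {m n : ℕ} (h : m ≤ n) (φ : L.BoundedFormula α m) :
    numAll (φ.castLE h) = numAll φ := by
  induction φ generalizing n with
  | falsum => simp [numAll]
  | equal => simp [numAll]
  | rel => simp [numAll]
  | imp _ _ ih1 ih2 => simp [numAll, ih1, ih2]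
  | all _ ih => simp [numAll, ih]

theorem hasPolarity_relabel {n : ℕ} (g : α → β ⊕ Fin n) {k : ℕ} (b : Bool)
    (φ : L.BoundedFormula α k) : HasPolarity b (φ.relabel g) ↔ HasPolarity b φ :=
  hasPolarity_mapTermRel _ _ _ (fun _ _ _ => hasPolarity_castLE _ _ _) _

theorem hasPolarity_liftAt {n k m : ℕ} (b : Bool) (φ : L.BoundedFormula α n) :
    HasPolarity b (φ.liftAt k m) ↔ HasPolarity b φ :=
  hasPolarity_mapTermRel _ _ _ (fun _ _ _ => hasPolarity_castLE _ _ _) _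

theorem numAll_liftAt {n k m : ℕ} (φ : L.BoundedFormula α n) :
    numAll (φ.liftAt k m) = numAll φ :=
  numAll_mapTermRel _ _ (fun _ _ => numAll_castLE _ _) _

theorem hasPolarity_of_isQF {n : ℕ} {φ : L.BoundedFormula α n} (h : φ.IsQF) (b : Bool) :
    HasPolarity b φ := by
  induction h generalizing b with
  | falsum => trivial
  | of_isAtomic h => cases h <;> trivial
  | imp _ _ ih1 ih2 => exact ⟨ih1 _, ih2 _⟩

theorem isQF_of_numAll_eq_zero {n : ℕ} {φ : L.BoundedFormula α n} (h : numAll φ = 0) :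
    φ.IsQF := by
  induction φ with
  | falsum => exact .falsum
  | equal t₁ t₂ => exact .of_isAtomic (.equal t₁ t₂)
  | rel R ts => exact .of_isAtomic (.rel R ts)
  | imp _ _ ih1 ih2 =>
    simp only [numAll, Nat.add_eq_zero_iff] at h
    exact .imp (ih1 h.1) (ih2 h.2)
  | all _ _ => simp [numAll] at h

theorem hasPolarity_ex {n : ℕ} (b : Bool) (φ : L.BoundedFormula α (n + 1)) :
    HasPolarity b φ.ex ↔ b = false ∧ HasPolarity b φ := by
  cases b <;> simp [HasPolarity]

theorem hasPolarity_toPrenexImpRight {n : ℕ} (φ ψ : L.BoundedFormula α n) (b : Bool) :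
    HasPolarity b (φ.toPrenexImpRight ψ) ↔ HasPolarity (!b) φ ∧ HasPolarity b ψ := by
  induction φ, ψ using BoundedFormula.toPrenexImpRight.induct with
  | case1 n φ ψ ih =>
    have e : φ.toPrenexImpRight ψ.ex = ((φ.liftAt 1 n).toPrenexImpRight ψ).ex := rfl
    have : HasPolarity b ψ.ex ↔ _ := hasPolarity_ex b ψ
    change HasPolarity b (φ.toPrenexImpRight ψ.ex) ↔ _ ∧ HasPolarity b ψ.ex
    rw [e, hasPolarity_ex, ih, hasPolarity_liftAt, this]
    tauto
  | case2 n φ ψ ih =>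
    rw [BoundedFormula.toPrenexImpRight]
    simp only [HasPolarity, ih, hasPolarity_liftAt]
    tauto
  | case3 n φ ψ h1 h2 =>
    rw [BoundedFormula.toPrenexImpRight]
    · simp [HasPolarity]
    · exact h1
    · exact h2

theorem hasPolarity_toPrenexImp {n : ℕ} (φ ψ : L.BoundedFormula α n) (b : Bool) :
    HasPolarity b (φ.toPrenexImp ψ) ↔ HasPolarity (!b) φ ∧ HasPolarity b ψ := by
  induction φ, ψ using BoundedFormula.toPrenexImp.induct with
  | case1 n φ ψ ih =>
    have e : φ.ex.toPrenexImp ψ = (φ.toPrenexImp (ψ.liftAt 1 n)).all := rfl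
    change HasPolarity b (φ.ex.toPrenexImp ψ) ↔ HasPolarity _ φ.ex ∧ _
    rw [e, hasPolarity_ex]
    simp only [HasPolarity, ih, hasPolarity_liftAt]
    cases b <;> simp
  | case2 n φ ψ ih =>
    rw [BoundedFormula.toPrenexImp, hasPolarity_ex, ih]
    simp only [HasPolarity, hasPolarity_liftAt]
    cases b <;> simp
  | case3 n φ ψ h1 h2 =>
    rw [BoundedFormula.toPrenexImp, hasPolarity_toPrenexImpRight]
    · exact h1
    · exact h2

/-- Polarity can be read off from the prenex normal form: pulling out a quantifier does not change
it into one of the wrong kind. -/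
theorem hasPolarity_toPrenex {n : ℕ} (φ : L.BoundedFormula α n) (b : Bool) :
    HasPolarity b φ.toPrenex ↔ HasPolarity b φ := by
  induction φ generalizing b with
  | falsum => exact Iff.rfl
  | equal => exact Iff.rfl
  | rel => exact Iff.rfl
  | imp _ _ ih1 ih2 =>
    rw [BoundedFormula.toPrenex, hasPolarity_toPrenexImp, ih1, ih2]; exact Iff.rfl
  | all _ ih => rw [BoundedFormula.toPrenex]; simp only [HasPolarity, ih]

theorem hasPolarity_of_isUniversal {n : ℕ} {φ : L.BoundedFormula α n} (h : φ.IsUniversal) :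
    HasPolarity true φ := by
  induction h with
  | of_isQF h => exact hasPolarity_of_isQF h _
  | all _ ih => exact ⟨rfl, ih⟩

theorem hasPolarity_of_isExistential {n : ℕ} {φ : L.BoundedFormula α n} (h : φ.IsExistential) :
    HasPolarity false φ := by
  induction h with
  | of_isQF h => exact hasPolarity_of_isQF h _
  | ex _ ih => exact (hasPolarity_ex _ _).2 ⟨rfl, ih⟩

/-! ### Pulling out quantifiers one at a time -/

/-- Strips the leftmost outermost quantifier of a formula with bound variables `0, …, n - 1`, whose
bound variable becomes the variable `n`; the bound variables of the other quantifiers are shifted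
to make room for it. Without a quantifier to strip, the variable `n` is a dummy. -/
def pull : ∀ {n : ℕ}, L.BoundedFormula α n → L.BoundedFormula α (n + 1)
  | n, .imp φ ψ => if numAll φ = 0 then (φ.liftAt 1 n).imp (pull ψ) else (pull φ).imp (ψ.liftAt 1 n)
  | _, .all φ => φ
  | n, .falsum => BoundedFormula.liftAt 1 n .falsum
  | n, .equal t₁ t₂ => BoundedFormula.liftAt 1 n (.equal t₁ t₂)
  | n, .rel R ts => BoundedFormula.liftAt 1 n (.rel R ts)

theorem numAll_pull {n : ℕ} (φ : L.BoundedFormula α n) : numAll (pull φ) = numAll φ - 1 := by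
  induction φ with
  | falsum => simp [pull, numAll_liftAt, numAll]
  | equal => simp [pull, numAll_liftAt, numAll]
  | rel => simp [pull, numAll_liftAt, numAll]
  | imp _ _ ih1 ih2 =>
    rw [pull]
    split_ifs with h <;> simp only [numAll, numAll_liftAt, ih1, ih2] <;> omega
  | all _ _ => simp [pull, numAll]

theorem hasPolarity_pull {n : ℕ} {φ : L.BoundedFormula α n} {b : Bool} (h : HasPolarity b φ) :
    HasPolarity b (pull φ) := by
  induction φ generalizing b with
  | falsum => simpa [pull, hasPolarity_liftAt] using h
  | equal => simpa [pull, hasPolarity_liftAt] using h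
  | rel => simpa [pull, hasPolarity_liftAt] using h
  | imp _ _ ih1 ih2 =>
    rw [pull]
    split_ifs with h'
    · exact ⟨(hasPolarity_liftAt _ _).2 h.1, ih2 h.2⟩
    · exact ⟨ih1 h.1, (hasPolarity_liftAt _ _).2 h.2⟩
  | all _ _ => exact h.2

theorem realize_pull {A : Type w} [L.Structure A] [Nonempty A] {n : ℕ} (φ : L.BoundedFormula α n)
    (v : α → A) (xs : Fin n → A) :
    (HasPolarity true φ → (φ.Realize v xs ↔ ∀ a, (pull φ).Realize v (Fin.snoc xs a))) ∧
      (HasPolarity false φ → (φ.Realize v xs ↔ ∃ a, (pull φ).Realize v (Fin.snoc xs a))) := by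
  have lift : ∀ {n : ℕ} (φ : L.BoundedFormula α n) (xs : Fin n → A) (a : A),
      (φ.liftAt 1 n).Realize v (Fin.snoc xs a) ↔ φ.Realize v xs := by
    intro n φ xs a
    rw [BoundedFormula.realize_liftAt_one_self, Fin.snoc_comp_castSucc]
  induction φ with
  | falsum => simp [pull, lift]
  | equal => simp [pull, lift]
  | rel => simp [pull, lift]
  | imp φ ψ ih1 ih2 =>
    rw [pull]
    split_ifs with h'
    · refine ⟨fun h => ?_, fun h => ?_⟩
      · simp only [BoundedFormula.realize_imp, lift, (ih2 xs).1 h.2]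
        exact ⟨fun h a hφ => h hφ a, fun h hφ a => h a hφ⟩
      · simp only [BoundedFormula.realize_imp, lift, (ih2 xs).2 h.2]
        by_cases hφ : φ.Realize v xs <;> simp [hφ]
    · refine ⟨fun h => ?_, fun h => ?_⟩
      · simp only [BoundedFormula.realize_imp, lift, (ih1 xs).2 h.1]
        simp
      · simp only [BoundedFormula.realize_imp, lift, (ih1 xs).1 h.1]
        exact forall_imp_iff_exists_imp
  | all φ _ =>
    exact ⟨fun _ => by simp [pull], fun h => by simp [HasPolarity] at h⟩

/-- The result of pulling out `n` quantifiers of a sentence. -/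
def pullIter (φ : L.Sentence) : ∀ n : ℕ, L.BoundedFormula Empty n
  | 0 => φ
  | n + 1 => pull (pullIter φ n)

theorem numAll_pullIter (φ : L.Sentence) (n : ℕ) : numAll (pullIter φ n) = numAll φ - n := by
  induction n with
  | zero => rfl
  | succ n ih => rw [pullIter, numAll_pull, ih]; omega

theorem hasPolarity_pullIter {φ : L.Sentence} (h : HasPolarity true φ) (n : ℕ) :
    HasPolarity true (pullIter φ n) := by
  induction n with
  | zero => exact h
  | succ n ih => exact hasPolarity_pull ih

theorem isUniversal_alls {n : ℕ} {φ : L.BoundedFormula α n} (h : φ.IsUniversal) :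
    BoundedFormula.IsUniversal φ.alls := by
  induction n with
  | zero => exact h
  | succ n ih => exact ih h.all

theorem hasPolarity_alls {n : ℕ} {φ : L.BoundedFormula α n} (h : HasPolarity true φ) :
    HasPolarity true (φ.alls : L.Formula α) := by
  induction n with
  | zero => exact h
  | succ n ih => exact ih ⟨rfl, h⟩

/-- Once all quantifiers of a sentence are pulled out, its closure is universal. -/
theorem isUniversal_alls_pullIter {φ : L.Sentence} {n : ℕ} (h : numAll φ ≤ n) :
    BoundedFormula.IsUniversal (pullIter φ n).alls :=
  isUniversal_alls (isQF_of_numAll_eq_zero (by rw [numAll_pullIter]; omega)).isUniversal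

theorem models_alls_pullIter {A : Type w} [L.Structure A] [Nonempty A] {φ : L.Sentence}
    (h : HasPolarity true φ) (n : ℕ) : A ⊨ ((pullIter φ n).alls : L.Sentence) ↔ A ⊨ φ := by
  induction n with
  | zero => exact Iff.rfl
  | succ n ih =>
    rw [← ih]
    simp only [Sentence.Realize, BoundedFormula.realize_alls]
    constructor
    · intro H xs
      exact ((realize_pull _ _ xs).1 (hasPolarity_pullIter h n)).2 fun a => H _
    · intro H xs
      have := ((realize_pull _ _ _).1 (hasPolarity_pullIter h n)).1 (H (Fin.init xs))
        (xs (Fin.last n))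
      rwa [Fin.snoc_init_self] at this

end Polarity

/-! ### Elimination of the predicates `C₁, …, C_K` -/

section Elimination

variable {L : FirstOrder.Language.{u, v}} {K : ℕ} {α : Type}

/-- Truth of an `L⁺`-formula with bound variables, where `C_k` is interpreted as the set `C k`. -/
def BoundedRealizeWith {A : Type w} [L.Structure A] {n : ℕ} (φ : (plusLang L K).BoundedFormula α n)
    (C : Fin K → Set A) (v : α → A) (xs : Fin n → A) : Prop :=
  letI : (predLang K).Structure A := predStructure C
  φ.Realize v xs

/-- A term of `L⁺` as a term of `L`, which has the same function symbols. -/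
def lowerTerm : (plusLang L K).Term α → L.Term α
  | .var a => .var a
  | .func (.inl f) ts => .func f fun i => lowerTerm (ts i)
  | .func (.inr e) _ => nomatch e

theorem realize_lowerTerm {A : Type w} [L.Structure A] (C : Fin K → Set A)
    (t : (plusLang L K).Term α) (v : α → A) :
    (lowerTerm t).realize v =
      (letI : (predLang K).Structure A := predStructure C; t.realize v) := by
  induction t with
  | var a => rfl
  | func f ts ih =>
    cases f with
    | inl f => simp only [lowerTerm, Term.realize, ih]; rfl
    | inr e => exact nomatch e

/-- The implication `φ₁ → (φ₂ → … → (φᵣ → ψ))`. -/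
def imps {n : ℕ} (l : List (L.BoundedFormula α n)) (ψ : L.BoundedFormula α n) :
    L.BoundedFormula α n :=
  l.foldr BoundedFormula.imp ψ

theorem realize_imps {A : Type w} [L.Structure A] {n : ℕ} (l : List (L.BoundedFormula α n))
    (ψ : L.BoundedFormula α n) (v : α → A) (xs : Fin n → A) :
    (imps l ψ).Realize v xs ↔ ((∀ φ ∈ l, φ.Realize v xs) → ψ.Realize v xs) := by
  induction l with
  | nil => simp [imps]
  | cons φ l ih =>
    change (φ.imp (imps l ψ)).Realize v xs ↔ _
    rw [BoundedFormula.realize_imp, ih]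
    simp only [List.mem_cons, forall_eq_or_imp, and_imp]

theorem isQF_imps {n : ℕ} {l : List (L.BoundedFormula α n)} {ψ : L.BoundedFormula α n}
    (hl : ∀ φ ∈ l, φ.IsQF) (hψ : ψ.IsQF) : (imps l ψ).IsQF := by
  induction l with
  | nil => exact hψ
  | cons φ l ih =>
    exact (hl φ (by simp)).imp (ih fun φ h => hl φ (by simp [h]))

theorem hasPolarity_imps {n : ℕ} {l : List (L.BoundedFormula α n)} {ψ : L.BoundedFormula α n}
    {b : Bool} (hl : ∀ φ ∈ l, HasPolarity (!b) φ) (hψ : HasPolarity b ψ) :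
    HasPolarity b (imps l ψ) := by
  induction l with
  | nil => exact hψ
  | cons φ l ih =>
    exact ⟨hl φ (by simp), ih fun φ h => hl φ (by simp [h])⟩

/-- The occurrences of the symbols `C_k` outside the scope of quantifiers, each with its argument. -/
def predAtoms : ∀ {n : ℕ}, (plusLang L K).BoundedFormula α n →
    List (Fin K × L.Term (α ⊕ Fin n))
  | _, .falsum => []
  | _, .equal _ _ => []
  | _, .rel (.inl _) _ => []
  | _, .rel (.inr (.C k)) ts => [(k, lowerTerm (ts 0))]
  | _, .imp φ ψ => predAtoms φ ++ predAtoms ψ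
  | _, .all _ => []

/-- Membership of `t` in the finite set of the values of those terms that `P` lists for the index
`k`, as an `L`-formula: the negation of the conjunction of the `t ≠ s`. -/
def memFormula {n : ℕ} (P : List (Fin K × L.Term (α ⊕ Fin n))) (k : Fin K)
    (t : L.Term (α ⊕ Fin n)) : L.BoundedFormula α n :=
  imps (P.map fun p => .imp (if p.1 = k then .equal t p.2 else .falsum) .falsum) .falsum

/-- The quantifier-free `L⁺`-formula `φ` with `C_k` replaced by the finite set of the values of those
terms that `P` lists for the index `k`. The value at quantified formulas is arbitrary. -/
def elimPred : ∀ {n : ℕ}, List (Fin K × L.Term (α ⊕ Fin n)) →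
    (plusLang L K).BoundedFormula α n → L.BoundedFormula α n
  | _, _, .falsum => .falsum
  | _, _, .equal t₁ t₂ => .equal (lowerTerm t₁) (lowerTerm t₂)
  | _, _, .rel (.inl R) ts => .rel R fun i => lowerTerm (ts i)
  | _, P, .rel (.inr (.C k)) ts => memFormula P k (lowerTerm (ts 0))
  | _, P, .imp φ ψ => .imp (elimPred P φ) (elimPred P ψ)
  | _, _, .all _ => .falsum

theorem isQF_elimPred {n : ℕ} (P : List (Fin K × L.Term (α ⊕ Fin n)))
    (φ : (plusLang L K).BoundedFormula α n) : (elimPred P φ).IsQF := by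
  induction φ with
  | falsum => exact .falsum
  | equal t₁ t₂ => exact .of_isAtomic (.equal _ _)
  | rel R ts =>
    rcases R with R | R
    · exact .of_isAtomic (.rel _ _)
    · cases R
      refine isQF_imps ?_ .falsum
      intro φ h
      obtain ⟨p, -, rfl⟩ := List.mem_map.1 h
      refine .imp ?_ .falsum
      split_ifs
      · exact .of_isAtomic (.equal _ _)
      · exact .falsum
  | imp _ _ ih1 ih2 => exact (ih1 P).imp (ih2 P)
  | all _ _ => exact .falsum

variable {A : Type w} [L.Structure A]

/-- The finite sets that a list `P` of indexed terms describes. -/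
def listedSets {n : ℕ} (P : List (Fin K × L.Term (α ⊕ Fin n))) (v : α → A) (xs : Fin n → A) :
    Fin K → Set A :=
  fun k => {a | ∃ p ∈ P, p.1 = k ∧ a = p.2.realize (Sum.elim v xs)}

theorem realize_memFormula {n : ℕ} (P : List (Fin K × L.Term (α ⊕ Fin n))) (k : Fin K)
    (t : L.Term (α ⊕ Fin n)) (v : α → A) (xs : Fin n → A) :
    (memFormula P k t).Realize v xs ↔ t.realize (Sum.elim v xs) ∈ listedSets P v xs k := by
  rw [memFormula, realize_imps]
  simp only [List.mem_map, forall_exists_index, and_imp, forall_apply_eq_imp_iff₂, listedSets,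
    Set.mem_ofPred_eq]
  change ((∀ p ∈ P, BoundedFormula.Realize (if p.1 = k then _ else _) v xs → False) → False) ↔ _
  constructor
  · intro h
    by_contra h'
    refine h fun p hp hr => h' ⟨p, hp, ?_⟩
    split_ifs at hr with hk
    · exact ⟨hk, hr⟩
    · exact hr.elim
  · rintro ⟨p, hp, hk, ht⟩ h
    refine h p hp ?_
    rw [if_pos hk]
    exact ht

theorem realize_elimPred_iff {n : ℕ} (P : List (Fin K × L.Term (α ⊕ Fin n)))
    {φ : (plusLang L K).BoundedFormula α n} (hφ : φ.IsQF) (v : α → A) (xs : Fin n → A)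
    (C : Fin K → Set A)
    (hC : ∀ p ∈ predAtoms φ, p.2.realize (Sum.elim v xs) ∈ C p.1 ↔
      p.2.realize (Sum.elim v xs) ∈ listedSets P v xs p.1) :
    (elimPred P φ).Realize v xs ↔ BoundedRealizeWith φ C v xs := by
  induction hφ with
  | falsum => exact Iff.rfl
  | of_isAtomic h =>
    cases h with
    | equal t₁ t₂ =>
      change Term.realize _ (lowerTerm t₁) = Term.realize _ (lowerTerm t₂) ↔ _
      rw [realize_lowerTerm C, realize_lowerTerm C]
      exact Iff.rfl
    | rel R ts =>
      rcases R with R | R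
      · change Structure.RelMap R (fun i => Term.realize _ (lowerTerm (ts i))) ↔ _
        simp only [realize_lowerTerm C]
        exact Iff.rfl
      · cases R with
        | C k =>
        refine (realize_memFormula P k _ v xs).trans ((hC (k, lowerTerm (ts 0)) ?_).symm.trans ?_)
        · simp [Relations.boundedFormula, predAtoms]
        · dsimp only
          rw [realize_lowerTerm C]
          exact Iff.rfl
  | imp _ _ ih1 ih2 =>
    exact imp_congr (ih1 fun p hp => hC p (by simp [predAtoms, hp]))
      (ih2 fun p hp => hC p (by simp [predAtoms, hp]))

theorem realize_elimPred_listedSets {n : ℕ} (P : List (Fin K × L.Term (α ⊕ Fin n)))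
    {φ : (plusLang L K).BoundedFormula α n} (hφ : φ.IsQF) (v : α → A) (xs : Fin n → A) :
    (elimPred P φ).Realize v xs ↔ BoundedRealizeWith φ (listedSets P v xs) v xs :=
  realize_elimPred_iff P hφ v xs _ fun _ _ => Iff.rfl

/-- The truth of a quantifier-free formula depends only on which of its atoms `C_k(t)` are true, so
that finitely many finite sets exhaust the behaviour of all choices of `C`. -/
theorem exists_realize_elimPred_iff {n : ℕ} {φ : (plusLang L K).BoundedFormula α n} (hφ : φ.IsQF)
    (v : α → A) (xs : Fin n → A) (C : Fin K → Set A) :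
    ∃ P ∈ (predAtoms φ).sublists',
      ((elimPred P φ).Realize v xs ↔ BoundedRealizeWith φ C v xs) := by
  classical
  refine ⟨(predAtoms φ).filter fun p => p.2.realize (Sum.elim v xs) ∈ C p.1,
    List.mem_sublists'.2 List.filter_sublist, realize_elimPred_iff _ hφ v xs C fun p hp => ?_⟩
  simp only [listedSets, List.mem_filter, decide_eq_true_eq, Set.mem_ofPred_eq]
  constructor
  · intro h
    exact ⟨p, ⟨hp, h⟩, rfl, rfl⟩
  · rintro ⟨q, ⟨-, hq⟩, h1, h2⟩
    rw [h2, ← h1]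
    exact hq

end Elimination

/-! ### First-order axioms for a separation rule -/

section Axioms

variable {L : FirstOrder.Language.{u, v}} {K : ℕ}

/-- The place of the variable `i` of the `j`-th tuple among the bound variables `0, …, m`. The values
of finitely many tuples can be chosen independently of each other if `m` is so large that the
truncation at `m` does not take effect. -/
def blockVar {N : ℕ} (j m : ℕ) (i : Fin N) : Empty ⊕ Fin (m + 1) :=
  .inr ⟨min (Nat.pair j i) m, Nat.lt_succ_of_le (min_le_right _ _)⟩

/-- The formula `φ`, applied to the `j`-th tuple of the variables `0, …, m`. -/
def toBlock {N : ℕ} (j m : ℕ) (φ : L.Formula (Fin N)) : L.BoundedFormula Empty (m + 1) :=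
  BoundedFormula.relabel (blockVar j m) φ

/-- The `j`-th tuple that is coded in the sequence `xs`. -/
def blockTuple {A : Type w} {N m : ℕ} (j : ℕ) (xs : Fin (m + 1) → A) (i : Fin N) : A :=
  xs ⟨min (Nat.pair j i) m, Nat.lt_succ_of_le (min_le_right _ _)⟩

theorem realize_toBlock {A : Type w} [L.Structure A] {N : ℕ} (j m : ℕ) (φ : L.Formula (Fin N))
    (v : Empty → A) (xs : Fin (m + 1) → A) :
    (toBlock j m φ).Realize v xs ↔ φ.Realize (blockTuple j xs) := by
  rw [toBlock, Formula.Realize]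
  refine (BoundedFormula.realize_relabel (n := 0)).trans ?_
  exact iff_of_eq (congrArg₂ _ rfl (Subsingleton.elim _ _))

/-- The negation of `η ∧ ψ₁ ∧ … ∧ ψᵣ`, where `η` is applied to the tuple `0` and `ψᵢ` to the tuple
whose number is listed along with its clause. -/
def refutation {N : ℕ} (η : (plusLang L K).Formula (Fin N)) (cl : List (ℕ × ClosureClause L K))
    (m : ℕ) : (plusLang L K).BoundedFormula Empty (m + 1) :=
  imps (toBlock 0 m η :: cl.map fun p => toBlock p.1 m p.2.ψ) .falsum

theorem isQF_refutation {N : ℕ} {η : (plusLang L K).Formula (Fin N)} (hη : BoundedFormula.IsQF η)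
    (cl : List (ℕ × ClosureClause L K)) (m : ℕ) : (refutation η cl m).IsQF := by
  refine isQF_imps ?_ .falsum
  simp only [List.mem_cons, List.mem_map, forall_eq_or_imp, forall_exists_index, and_imp,
    forall_apply_eq_imp_iff₂]
  exact ⟨hη.relabel _, fun p _ => p.2.ψ_isQF.relabel _⟩

theorem boundedRealizeWith_refutation {A : Type w} [L.Structure A] {N : ℕ}
    (η : (plusLang L K).Formula (Fin N)) (cl : List (ℕ × ClosureClause L K)) (m : ℕ)
    (C : Fin K → Set A) (v : Empty → A) (xs : Fin (m + 1) → A) :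
    BoundedRealizeWith (refutation η cl m) C v xs ↔
      ¬(RealizeWith η C (blockTuple 0 xs) ∧
        ∀ p ∈ cl, RealizeWith p.2.ψ C (blockTuple p.1 xs)) := by
  let _ : (predLang K).Structure A := predStructure C
  refine (realize_imps _ _ v xs).trans ?_
  simp only [List.mem_cons, List.mem_map, forall_eq_or_imp, forall_exists_index, and_imp,
    forall_apply_eq_imp_iff₂, realize_toBlock]
  exact not_and.symm

/-- The sentence that says: if `μ` and the premises of the listed clauses hold for given tuples,
then some `C₁, …, C_K` satisfy `η` and the conclusions of these clauses for the given tuples. -/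
def ruleAxiom {N : ℕ} (μ : L.Formula (Fin N)) (η : (plusLang L K).Formula (Fin N))
    (cl : List (ℕ × ClosureClause L K)) (m : ℕ) : L.Sentence :=
  BoundedFormula.alls (imps
    (toBlock 0 m μ :: (cl.map (fun p => toBlock p.1 m p.2.γ) ++
      (predAtoms (refutation η cl m)).sublists'.map fun P => elimPred P (refutation η cl m)))
    .falsum)

theorem hasPolarity_ruleAxiom {N : ℕ} {μ : L.Formula (Fin N)}
    {η : (plusLang L K).Formula (Fin N)} {cl : List (ℕ × ClosureClause L K)} (m : ℕ)
    (hμ : HasPolarity false μ) (hcl : ∀ p ∈ cl, HasPolarity false p.2.γ) :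
    HasPolarity true (ruleAxiom μ η cl m) := by
  refine hasPolarity_alls (hasPolarity_imps ?_ trivial)
  intro φ hφ
  simp only [List.mem_cons, List.mem_append, List.mem_map] at hφ
  rcases hφ with rfl | ⟨p, hp, rfl⟩ | ⟨P, -, rfl⟩
  · exact (hasPolarity_relabel _ _ _).2 hμ
  · exact (hasPolarity_relabel _ _ _).2 (hcl p hp)
  · exact hasPolarity_of_isQF (isQF_elimPred _ _) _

theorem models_ruleAxiom {A : Type w} [L.Structure A] {N : ℕ} (μ : L.Formula (Fin N))
    {η : (plusLang L K).Formula (Fin N)} (hη : BoundedFormula.IsQF η)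
    (cl : List (ℕ × ClosureClause L K)) (m : ℕ) :
    A ⊨ ruleAxiom μ η cl m ↔ ∀ xs : Fin (m + 1) → A, μ.Realize (blockTuple 0 xs) →
      (∀ p ∈ cl, p.2.γ.Realize (blockTuple p.1 xs)) →
      ∃ C : Fin K → Set A, RealizeWith η C (blockTuple 0 xs) ∧
        ∀ p ∈ cl, RealizeWith p.2.ψ C (blockTuple p.1 xs) := by
  rw [ruleAxiom, Sentence.Realize, BoundedFormula.realize_alls]
  refine forall_congr' fun xs => ?_
  rw [realize_imps]
  simp only [List.mem_cons, List.mem_append, or_imp, forall_and, forall_eq, List.mem_map,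
    forall_exists_index, and_imp, forall_apply_eq_imp_iff₂, realize_toBlock]
  refine imp_congr_right fun _ => imp_congr_right fun _ => ?_
  constructor
  · intro h
    by_contra hC
    refine h fun P _ => ?_
    rw [realize_elimPred_listedSets P (isQF_refutation hη cl m), boundedRealizeWith_refutation]
    exact fun h' => hC ⟨_, h'⟩
  · rintro ⟨C, hC⟩ h
    obtain ⟨P, hP, h'⟩ :=
      exists_realize_elimPred_iff (isQF_refutation hη cl m) default xs C
    exact (boundedRealizeWith_refutation η cl m C _ xs).1 (h'.1 (h P hP)) hC

theorem isClopen_setOf_const {X : Type*} [TopologicalSpace X] (p : Prop) :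
    IsClopen {_x : X | p} := by
  by_cases h : p <;> simp [h, isClopen_univ, isClopen_empty]

/-- The set of those `C` that satisfy a given quantifier-free condition is open and closed in the
product topology, as the condition depends on finitely many truth values only. -/
theorem isClopen_boundedRealizeWith {A : Type w} [L.Structure A] {α : Type} {n : ℕ}
    {φ : (plusLang L K).BoundedFormula α n} (hφ : φ.IsQF) (v : α → A) (xs : Fin n → A) :
    IsClopen {f : Fin K → A → Bool | BoundedRealizeWith φ (fun k => {a | f k a = true}) v xs} := by
  induction hφ with
  | falsum => exact isClopen_empty
  | of_isAtomic h =>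
    cases h with
    | equal t₁ t₂ =>
      have : ∀ f : Fin K → A → Bool,
          BoundedRealizeWith (t₁.bdEqual t₂) (fun k => {a | f k a = true}) v xs ↔
          (lowerTerm t₁).realize (Sum.elim v xs) = (lowerTerm t₂).realize (Sum.elim v xs) := by
        intro f
        rw [realize_lowerTerm fun k => {a | f k a = true},
          realize_lowerTerm fun k => {a | f k a = true}]
        exact Iff.rfl
      simp only [this]
      exact isClopen_setOf_const _
    | rel R ts =>
      rcases R with R | R
      · have : ∀ f : Fin K → A → Bool,
            BoundedRealizeWith (Relations.boundedFormula (L := plusLang L K) (Sum.inl R) ts)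
              (fun k => {a | f k a = true}) v xs ↔
            Structure.RelMap R (fun i => (lowerTerm (ts i)).realize (Sum.elim v xs)) := by
          intro f
          simp only [realize_lowerTerm fun k => {a | f k a = true}]
          exact Iff.rfl
        simp only [this]
        exact isClopen_setOf_const _
      · cases R with
        | C k =>
        have : ∀ f : Fin K → A → Bool,
            BoundedRealizeWith (Relations.boundedFormula (L := plusLang L K)
              (Sum.inr (PredSymbol.C k)) ts) (fun k => {a | f k a = true}) v xs ↔
            f k ((lowerTerm (ts 0)).realize (Sum.elim v xs)) = true := by
          intro f
          rw [realize_lowerTerm fun k => {a | f k a = true}]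
          exact Iff.rfl
        simp only [this]
        exact (isClopen_discrete {true}).preimage
          ((continuous_apply (A := fun _ : A => Bool) _).comp (continuous_apply k))
  | @imp φ ψ _ _ ih1 ih2 => exact ih1.himp ih2

theorem isClosed_realizeWith {A : Type w} [L.Structure A] {N : ℕ}
    {φ : (plusLang L K).Formula (Fin N)} (hφ : BoundedFormula.IsQF φ) (x : Fin N → A) :
    IsClosed {f : Fin K → A → Bool | RealizeWith φ (fun k => {a | f k a = true}) x} :=
  (isClopen_boundedRealizeWith hφ x default).1

/-- By compactness, `C₁, …, C_K` as in a separation rule exist as soon as they exist for finitely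
many instances of its clauses at a time. -/
theorem holds_pos_iff_models_ruleAxiom {A : Type w} [L.Structure A] [Nonempty A] {N : ℕ}
    (hK : 1 ≤ K) (μ : L.Formula (Fin N)) {η : (plusLang L K).Formula (Fin N)}
    (hη : BoundedFormula.IsQF η) (τ : Set (ClosureClause L K)) :
    (SeparationRule.pos N K hK μ η hη τ).Holds A ↔
      ∀ (cl : List (ℕ × ClosureClause L K)), (∀ p ∈ cl, p.2 ∈ τ) →
        ∀ m : ℕ, A ⊨ ruleAxiom μ η cl m := by
  constructor
  · intro h cl hcl m
    rw [models_ruleAxiom μ hη]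
    intro xs hμ hγ
    obtain ⟨C, hC, hτ⟩ := h _ hμ
    exact ⟨C, hC, fun p hp => hτ p.2 (hcl p hp) _ (hγ p hp)⟩
  · intro h x hμ
    -- The index set of the clause instances that have to be satisfied.
    let I := {q : Σ c : ClosureClause L K, Fin c.M → A // q.1 ∈ τ ∧ q.1.γ.Realize q.2}
    let S : I → Set (Fin K → A → Bool) := fun q =>
      {f | RealizeWith q.1.1.ψ (fun k => {a | f k a = true}) q.1.2}
    let S₀ : Set (Fin K → A → Bool) := {f | RealizeWith η (fun k => {a | f k a = true}) x}
    have hne : (S₀ ∩ ⋂ q, S q).Nonempty := by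
      refine (isClosed_realizeWith hη x).isCompact.inter_iInter_nonempty S
        (fun q => isClosed_realizeWith q.1.1.ψ_isQF q.1.2) fun F => ?_
      classical
      -- The instances are numbered from 1, since the number 0 stands for the tuple `x`.
      let idx : I → ℕ := fun q => F.toList.idxOf q + 1
      have hidx : ∀ p ∈ F, ∀ q ∈ F, idx p = idx q → p = q := fun p hp q _ hpq =>
        (List.idxOf_inj (Finset.mem_toList.2 hp)).1 (Nat.succ_injective hpq)
      let cl : List (ℕ × ClosureClause L K) := F.toList.map fun q => (idx q, q.1.1)
      -- A bound that is so large that no tuple is truncated.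
      obtain ⟨m, hm⟩ : ∃ m : ℕ, (∀ i : Fin N, Nat.pair 0 i ≤ m) ∧
          ∀ q ∈ F, ∀ i : Fin q.1.1.M, Nat.pair (idx q) i ≤ m := by
        refine ⟨(Finset.univ.sup fun i : Fin N => Nat.pair 0 i) +
          F.sup fun q => Finset.univ.sup fun i : Fin q.1.1.M => Nat.pair (idx q) i,
          fun i => ?_, fun q hq i => ?_⟩
        · exact le_add_right (Finset.le_sup (f := fun i : Fin N => Nat.pair 0 i)
            (Finset.mem_univ i))
        · exact le_add_left ((Finset.le_sup (f := fun i : Fin q.1.1.M => Nat.pair (idx q) i)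
            (Finset.mem_univ i)).trans (Finset.le_sup (f := fun q : I =>
              Finset.univ.sup fun i : Fin q.1.1.M => Nat.pair (idx q) i) hq))
      inhabit A
      let val : ℕ → A := fun r =>
        if h0 : r.unpair.1 = 0 then (if h : r.unpair.2 < N then x ⟨_, h⟩ else default)
        else if h : ∃ q ∈ F, idx q = r.unpair.1 then
          (if h' : r.unpair.2 < h.choose.1.1.M then h.choose.1.2 ⟨_, h'⟩ else default)
        else default
      let xs : Fin (m + 1) → A := fun r => val r
      have hx : blockTuple 0 xs = x := by
        funext i
        simp [blockTuple, xs, val, min_eq_left (hm.1 i)]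
      have hq : ∀ q ∈ F, blockTuple (idx q) xs = q.1.2 := by
        intro q hq
        funext i
        have hex : ∃ p ∈ F, idx p = (Nat.pair (idx q) i).unpair.1 := ⟨q, hq, by simp⟩
        have hc : hex.choose = q :=
          hidx _ hex.choose_spec.1 _ hq (hex.choose_spec.2.trans (by simp))
        have h0 : (Nat.pair (idx q) i).unpair.1 ≠ 0 := by simp [idx]
        have key : ∀ p : I, p = q → (if h' : (Nat.pair (idx q) i).unpair.2 < p.1.1.M
            then p.1.2 ⟨_, h'⟩ else default) = q.1.2 i := by
          rintro p rfl
          simp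
        have hmin : blockTuple (idx q) xs i = val (Nat.pair (idx q) i) := by
          simp [blockTuple, xs, min_eq_left (hm.2 q hq i)]
        rw [hmin]
        change (if h0 : _ then _ else _) = _
        rw [dif_neg h0, dif_pos hex]
        exact key _ hc
      have hax := (models_ruleAxiom μ hη cl m).1 (h cl (by
        intro p hp
        obtain ⟨q, -, rfl⟩ := List.mem_map.1 hp
        exact q.2.1) m) xs (by rwa [hx]) (by
        intro p hp
        obtain ⟨q, hqF, rfl⟩ := List.mem_map.1 hp
        have := q.2.2
        rwa [← hq q (Finset.mem_toList.1 hqF)] at this)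
      obtain ⟨C, hC, hcl⟩ := hax
      have hCf : (fun k => {a | decide (a ∈ C k) = true}) = C := by
        funext k; ext a; simp
      refine ⟨fun k a => decide (a ∈ C k), ?_, Set.mem_iInter₂.2 fun q hqF => ?_⟩
      · change RealizeWith η (fun k => {a | decide (a ∈ C k) = true}) x
        rwa [hCf, ← hx]
      · change RealizeWith q.1.1.ψ (fun k => {a | decide (a ∈ C k) = true}) q.1.2
        rw [hCf, ← hq q hqF]
        exact hcl (idx q, q.1.1) (List.mem_map.2 ⟨q, Finset.mem_toList.2 hqF, rfl⟩)
    obtain ⟨f, hf, hS⟩ := hne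
    exact ⟨_, hf, fun c hc y hy => Set.mem_iInter.1 hS ⟨⟨c, y⟩, hc, hy⟩⟩

/-- The theory that consists of the order zero rules and the first-order axioms for the rules of
positive order. -/
inductive SchemeTheory (S : Set (SeparationRule L)) : L.Theory
  | zero {φ : L.Sentence} (h : .zero φ ∈ S) : SchemeTheory S φ
  | pos {N K : ℕ} {hK : 1 ≤ K} {μ : L.Formula (Fin N)} {η : (plusLang L K).Formula (Fin N)}
      {hη : BoundedFormula.IsQF η} {τ : Set (ClosureClause L K)} (h : .pos N K hK μ η hη τ ∈ S)
      (cl : List (ℕ × ClosureClause L K)) (hcl : ∀ p ∈ cl, p.2 ∈ τ) (m : ℕ) :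
      SchemeTheory S (ruleAxiom μ η cl m)

theorem models_schemeTheory {A : Type w} [L.Structure A] [Nonempty A]
    (S : Set (SeparationRule L)) : A ⊨ (SchemeTheory S : L.Theory) ↔ ∀ σ ∈ S, σ.Holds A := by
  rw [Theory.model_iff]
  constructor
  · rintro h (φ | ⟨N, K, hK, μ, η, hη, τ⟩) hσ
    · exact h _ (.zero hσ)
    · exact (holds_pos_iff_models_ruleAxiom hK μ hη τ).2 fun cl hcl m => h _ (.pos hσ cl hcl m)
  · rintro h _ (hφ | ⟨hσ, cl, hcl, m⟩)
    · exact h _ hφ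
    · exact (holds_pos_iff_models_ruleAxiom _ _ _ _).1 (h _ hσ) cl hcl m

theorem hasPolarity_of_mem_schemeTheory {S : Set (SeparationRule L)}
    (hS : ∀ σ ∈ S, σ.MeetsUniversalCondition) {φ : L.Sentence} (h : φ ∈ (SchemeTheory S : L.Theory)) :
    HasPolarity true φ := by
  rcases h with hφ | ⟨hσ, cl, hcl, m⟩
  · exact (hasPolarity_toPrenex _ _).1 (hasPolarity_of_isUniversal (hS _ hφ))
  · have h := hS _ hσ
    exact hasPolarity_ruleAxiom m ((hasPolarity_toPrenex _ _).1 (hasPolarity_of_isExistential h.1))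
      fun p hp => (hasPolarity_toPrenex _ _).1 (hasPolarity_of_isExistential (h.2 _ (hcl p hp)))

end Axioms

/-! ### Recursion on codes -/

section CodeRecursion

variable {σ : Type*} {ρ : Type*}

/-- Course-of-values recursion: `g` computes the value at `n` from the list of the values at
`0, …, n - 1`. -/
noncomputable def tableRec (g : List σ → σ) (n : ℕ) : σ :=
  Nat.strongRecOn n fun n ih => g (List.ofFn fun i : Fin n => ih i i.2)

theorem tableRec_eq (g : List σ → σ) (n : ℕ) :
    tableRec g n = g ((List.range n).map (tableRec g)) := by
  rw [tableRec, Nat.strongRecOn_eq]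
  congr 1
  apply List.ext_getElem
  · simp
  · intro i h1 h2
    simp [tableRec]

theorem primrec_tableRec [Primcodable σ] [Primcodable ρ] {g : ρ → List σ → σ} (hg : Primrec₂ g) :
    Primrec₂ fun a n => tableRec (g a) n :=
  Primrec.nat_strong_rec _ (g := fun a l => some (g a l)) (Primrec.option_some.comp hg) fun a n => by
    rw [tableRec_eq]

theorem lt_encode_of_mem {l : List ℕ} {x : ℕ} (h : x ∈ l) : x < Encodable.encode l := by
  induction l with
  | nil => simp at h
  | cons y l ih =>
    rw [Encodable.encode_list_cons]
    rcases List.mem_cons.1 h with rfl | h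
    · exact Nat.lt_succ_of_le (Nat.left_le_pair _ _)
    · exact (ih h).trans (Nat.lt_succ_of_le (Nat.right_le_pair _ _))

theorem getD_map_range [Inhabited σ] (f : ℕ → σ) {i n : ℕ} (h : i < n) :
    ((List.range n).map f).getD i default = f i := by
  simp [List.getD, h]

/-- The number of a term after the numbers of its variables are changed by `f`. -/
noncomputable def termMapCode (f : ℕ → ℕ) : ℕ → ℕ :=
  tableRec fun l =>
    if l.length.unpair.1 = 0 then Nat.pair 0 (f l.length.unpair.2)
    else Nat.pair 1 (Nat.pair l.length.unpair.2.unpair.1 (Encodable.encode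
      ((Denumerable.ofNat (List ℕ) l.length.unpair.2.unpair.2).map fun i => l.getD i default)))

theorem termMapCode_var (f : ℕ → ℕ) (x : ℕ) : termMapCode f (Nat.pair 0 x) = Nat.pair 0 (f x) := by
  rw [termMapCode, tableRec_eq]; simp

theorem termMapCode_func (f : ℕ → ℕ) (s : ℕ) (l : List ℕ) :
    termMapCode f (Nat.pair 1 (Nat.pair s (Encodable.encode l))) =
      Nat.pair 1 (Nat.pair s (Encodable.encode (l.map (termMapCode f)))) := by
  rw [termMapCode, tableRec_eq]
  simp only [List.length_map, List.length_range, Nat.unpair_pair, one_ne_zero, if_false,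
    Denumerable.ofNat_encode]
  congr 3
  refine List.map_congr_left fun i hi => getD_map_range _ ?_
  exact (lt_encode_of_mem hi).trans_le ((Nat.right_le_pair _ _).trans (Nat.right_le_pair _ _))

theorem primrec_termMapCode [Primcodable ρ] {f : ρ → ℕ → ℕ} (hf : Primrec₂ f) :
    Primrec₂ fun a c => termMapCode (f a) c := by
  refine primrec_tableRec (g := fun a l => _) ?_
  have len : Primrec fun p : ρ × List ℕ => p.2.length := Primrec.list_length.comp Primrec.snd
  have u1 : Primrec fun p : ρ × List ℕ => p.2.length.unpair.1 :=
    Primrec.fst.comp (Primrec.unpair.comp len)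
  have u2 : Primrec fun p : ρ × List ℕ => p.2.length.unpair.2 :=
    Primrec.snd.comp (Primrec.unpair.comp len)
  have u21 := Primrec.fst.comp (Primrec.unpair.comp u2)
  have u22 := Primrec.snd.comp (Primrec.unpair.comp u2)
  refine Primrec.ite (Primrec.eq.comp u1 (Primrec.const 0))
    (Primrec₂.natPair.comp (Primrec.const 0) (hf.comp Primrec.fst u2))
    (Primrec₂.natPair.comp (Primrec.const 1) (Primrec₂.natPair.comp u21
      (Primrec.encode.comp (Primrec.list_map ((Primrec.ofNat (List ℕ)).comp u22) ?_))))
  exact (Primrec.list_getD default).comp (Primrec.snd.comp Primrec.fst) Primrec.snd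

/-- Recursion on codes of formulas: `hA` gives the value at the code of an atomic formula, `hI` the
value at an implication and `hQ` the value at a quantified formula, from the codes of the immediate
subformulas and from the values there. Numbers that are not codes get a value, too, which is
irrelevant. -/
noncomputable def formulaRec [Inhabited σ] (hA : ℕ → σ) (hI : (ℕ × ℕ) × (σ × σ) → σ) (hQ : ℕ × σ → σ) : ℕ → σ :=
  tableRec fun l =>
    if l.length.unpair.1 = 3 then
      hI (l.length.unpair.2.unpair,
        (l.getD l.length.unpair.2.unpair.1 default, l.getD l.length.unpair.2.unpair.2 default))
    else if l.length.unpair.1 = 4 then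
      hQ (l.length.unpair.2, l.getD l.length.unpair.2 default)
    else hA l.length

section
variable [Inhabited σ] (hA : ℕ → σ) (hI : (ℕ × ℕ) × (σ × σ) → σ) (hQ : ℕ × σ → σ)

theorem formulaRec_atom {t : ℕ} (ht : t < 3) (x : ℕ) :
    formulaRec hA hI hQ (Nat.pair t x) = hA (Nat.pair t x) := by
  rw [formulaRec, tableRec_eq]
  simp only [List.length_map, List.length_range, Nat.unpair_pair]
  rw [if_neg (by omega), if_neg (by omega)]

theorem lt_pair_of_pos {t x y : ℕ} (ht : 0 < t) (h : x ≤ y) : x < Nat.pair t y :=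
  h.trans_lt ((Nat.right_le_pair 0 y).trans_lt (Nat.pair_lt_pair_left y ht))

theorem formulaRec_imp (x y : ℕ) :
    formulaRec hA hI hQ (Nat.pair 3 (Nat.pair x y)) =
      hI ((x, y), (formulaRec hA hI hQ x, formulaRec hA hI hQ y)) := by
  rw [formulaRec, tableRec_eq]
  simp only [List.length_map, List.length_range, Nat.unpair_pair, if_true]
  rw [getD_map_range _ (lt_pair_of_pos (by omega) (Nat.left_le_pair _ _)),
    getD_map_range _ (lt_pair_of_pos (by omega) (Nat.right_le_pair _ _))]

theorem formulaRec_all (x : ℕ) :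
    formulaRec hA hI hQ (Nat.pair 4 x) = hQ (x, formulaRec hA hI hQ x) := by
  rw [formulaRec, tableRec_eq]
  simp only [List.length_map, List.length_range, Nat.unpair_pair, if_true]
  rw [if_neg (by omega), getD_map_range _ (lt_pair_of_pos (by omega) le_rfl)]

end

theorem primrec_formulaRec [Primcodable ρ] [Primcodable σ] [Inhabited σ] {hA : ρ → ℕ → σ}
    {hI : ρ → (ℕ × ℕ) × (σ × σ) → σ} {hQ : ρ → ℕ × σ → σ} (pA : Primrec₂ hA) (pI : Primrec₂ hI)
    (pQ : Primrec₂ hQ) : Primrec₂ fun a c => formulaRec (hA a) (hI a) (hQ a) c := by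
  refine primrec_tableRec (g := fun a l => _) ?_
  have len : Primrec fun p : ρ × List σ => p.2.length := Primrec.list_length.comp Primrec.snd
  have u1 : Primrec fun p : ρ × List σ => p.2.length.unpair.1 :=
    Primrec.fst.comp (Primrec.unpair.comp len)
  have u2 : Primrec fun p : ρ × List σ => p.2.length.unpair.2 :=
    Primrec.snd.comp (Primrec.unpair.comp len)
  have u2' := Primrec.unpair.comp u2
  have get : ∀ {k : ρ × List σ → ℕ}, Primrec k →
      Primrec fun p : ρ × List σ => p.2.getD (k p) default := fun hk =>
    (Primrec.list_getD default).comp Primrec.snd hk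
  exact Primrec.ite (Primrec.eq.comp u1 (Primrec.const 3))
    (pI.comp Primrec.fst (u2'.pair
      ((get (Primrec.fst.comp u2')).pair (get (Primrec.snd.comp u2')))))
    (Primrec.ite (Primrec.eq.comp u1 (Primrec.const 4))
      (pQ.comp Primrec.fst (u2.pair (get u2))) (pA.comp Primrec.fst len))

end CodeRecursion

/-! ### Operations on formulas as operations on codes -/

section Codes

variable {ρ : Type*} [Primcodable ρ]

/-- The code of an implication. -/
def impCode (x y : ℕ) : ℕ := Nat.pair 3 (Nat.pair x y)

/-- The code of the falsum. -/
def falsumCode : ℕ := Nat.pair 0 0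

/-- The code of an atomic formula after all terms in it are changed by `F`. -/
def atomMapCode (F : ℕ → ℕ) (c : ℕ) : ℕ :=
  if c.unpair.1 = 1 then
    Nat.pair 1 (Nat.pair (F c.unpair.2.unpair.1) (F c.unpair.2.unpair.2))
  else if c.unpair.1 = 2 then
    Nat.pair 2 (Nat.pair c.unpair.2.unpair.1
      (Encodable.encode ((Denumerable.ofNat (List ℕ) c.unpair.2.unpair.2).map F)))
  else c

/-- The code of a formula after the numbers of its variables, free or bound, are changed by `f`. -/
noncomputable def formulaMapCode (f : ℕ → ℕ) : ℕ → ℕ :=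
  formulaRec (atomMapCode (termMapCode f)) (fun p => impCode p.2.1 p.2.2) fun p => Nat.pair 4 p.2

/-- The number of quantifiers of a formula, in terms of its code. -/
noncomputable def numAllCode : ℕ → ℕ :=
  formulaRec (fun _ => 0) (fun p => p.2.1 + p.2.2) fun p => p.2 + 1

/-- The change of the numbers of the variables when the bound variables from `n` on are shifted.
Bound variables have odd numbers. -/
def liftVar (n c : ℕ) : ℕ := if c % 2 = 0 then c else if c / 2 < n then c else c + 2

/-- The code of `pull φ`, in terms of the code of `φ`. -/
noncomputable def pullCode (n : ℕ) : ℕ → ℕ :=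
  formulaRec (formulaMapCode (liftVar n))
    (fun p => if numAllCode p.1.1 = 0 then impCode (formulaMapCode (liftVar n) p.1.1) p.2.2
      else impCode p.2.1 (formulaMapCode (liftVar n) p.1.2))
    fun p => p.1

/-- The change of the numbers of the variables by `toBlock j m`. -/
def blockVarCode (p : ℕ × ℕ) (c : ℕ) : ℕ :=
  if c % 2 = 0 then 2 * min (Nat.pair p.1 (c / 2)) p.2 + 1 else 2 * (p.2 + 1 + c / 2) + 1

/-- The code of `imps l ψ`. -/
def impsCode (l : List ℕ) (x : ℕ) : ℕ := l.foldr impCode x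

/-- The argument of the atomic formula `C_k(t)` with the given code. -/
def predArgCode (c : ℕ) : ℕ := (Denumerable.ofNat (List ℕ) c.unpair.2.unpair.2).headI

/-- The pairs of `predAtoms φ`, coded by pairs of numbers. -/
noncomputable def predAtomsCode : ℕ → List (ℕ × ℕ) :=
  formulaRec (fun c => if c.unpair.1 = 2 then
      if c.unpair.2.unpair.1 % 2 = 1 then [(c.unpair.2.unpair.1 / 2, predArgCode c)] else []
    else []) (fun p => p.2.1 ++ p.2.2) fun _ => []

/-- The code of `memFormula P k t`. -/
def memFormulaCode (P : List (ℕ × ℕ)) (k t : ℕ) : ℕ :=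
  impsCode (P.map fun p => impCode
    (if p.1 = k then Nat.pair 1 (Nat.pair t p.2) else falsumCode) falsumCode) falsumCode

/-- The code of `elimPred P φ`. -/
noncomputable def elimPredCode (P : List (ℕ × ℕ)) : ℕ → ℕ :=
  formulaRec (fun c => if c.unpair.1 = 2 then
      if c.unpair.2.unpair.1 % 2 = 1 then memFormulaCode P (c.unpair.2.unpair.1 / 2) (predArgCode c)
      else Nat.pair 2 (Nat.pair (c.unpair.2.unpair.1 / 2) c.unpair.2.unpair.2)
    else c) (fun p => impCode p.2.1 p.2.2) fun _ => falsumCode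

/-- The code of `refutation η cl m`. -/
noncomputable def refutationCode (η : ℕ) (cl : List (ℕ × ℕ)) (m : ℕ) : ℕ :=
  impsCode (formulaMapCode (blockVarCode (0, m)) η ::
    cl.map fun p => formulaMapCode (blockVarCode (p.1, m)) p.2.unpair.2.unpair.2) falsumCode

/-- The code of the universal closure of a formula with `n` bound variables. -/
def allsCode (n c : ℕ) : ℕ := (Nat.pair 4)^[n] c

/-- The code of `ruleAxiom μ η cl m`. -/
noncomputable def ruleAxiomCode (μ η : ℕ) (cl : List (ℕ × ℕ)) (m : ℕ) : ℕ :=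
  allsCode (m + 1) (impsCode (formulaMapCode (blockVarCode (0, m)) μ ::
    (cl.map (fun p => formulaMapCode (blockVarCode (p.1, m)) p.2.unpair.2.unpair.1) ++
      (predAtomsCode (refutationCode η cl m)).sublists'.map fun P =>
        elimPredCode P (refutationCode η cl m))) falsumCode)

theorem primrec_impCode : Primrec₂ impCode :=
  Primrec₂.natPair.comp (Primrec.const 3) (Primrec₂.natPair.comp Primrec.fst Primrec.snd)

theorem primrec_impsCode : Primrec₂ impsCode :=
  Primrec.list_foldr (h := fun _ p => impCode p.1 p.2) Primrec.fst Primrec.snd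
    (primrec_impCode.comp (Primrec.fst.comp Primrec.snd) (Primrec.snd.comp Primrec.snd))

theorem primrec_unpair_fst {f : ρ → ℕ} (hf : Primrec f) : Primrec fun a => (f a).unpair.1 :=
  Primrec.fst.comp (Primrec.unpair.comp hf)

theorem primrec_unpair_snd {f : ρ → ℕ} (hf : Primrec f) : Primrec fun a => (f a).unpair.2 :=
  Primrec.snd.comp (Primrec.unpair.comp hf)

theorem primrec_atomMapCode {F : ρ → ℕ → ℕ} (hF : Primrec₂ F) :
    Primrec₂ fun a c => atomMapCode (F a) c := by
  have c2 : Primrec fun p : ρ × ℕ => p.2 := Primrec.snd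
  have u1 := primrec_unpair_fst c2
  have u21 := primrec_unpair_fst (primrec_unpair_snd c2)
  have u22 := primrec_unpair_snd (primrec_unpair_snd c2)
  refine Primrec.ite (Primrec.eq.comp u1 (Primrec.const 1))
    (Primrec₂.natPair.comp (Primrec.const 1) (Primrec₂.natPair.comp
      (hF.comp Primrec.fst u21) (hF.comp Primrec.fst u22)))
    (Primrec.ite (Primrec.eq.comp u1 (Primrec.const 2))
      (Primrec₂.natPair.comp (Primrec.const 2) (Primrec₂.natPair.comp u21
        (Primrec.encode.comp (Primrec.list_map ((Primrec.ofNat (List ℕ)).comp u22) ?_)))) c2)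
  exact hF.comp (Primrec.fst.comp Primrec.fst) Primrec.snd

theorem primrec_formulaMapCode {f : ρ → ℕ → ℕ} (hf : Primrec₂ f) :
    Primrec₂ fun a c => formulaMapCode (f a) c := by
  refine primrec_formulaRec (primrec_atomMapCode (primrec_termMapCode hf)) ?_ ?_
  · exact primrec_impCode.comp (Primrec.fst.comp (Primrec.snd.comp Primrec.snd))
      (Primrec.snd.comp (Primrec.snd.comp Primrec.snd))
  · exact Primrec₂.natPair.comp (Primrec.const 4) (Primrec.snd.comp Primrec.snd)

theorem primrec_numAllCode : Primrec numAllCode := by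
  have : Primrec₂ fun (_ : Unit) (c : ℕ) => numAllCode c := by
    refine primrec_formulaRec ?_ ?_ ?_
    · exact Primrec.const 0
    · exact Primrec.nat_add.comp (Primrec.fst.comp (Primrec.snd.comp Primrec.snd))
        (Primrec.snd.comp (Primrec.snd.comp Primrec.snd))
    · exact Primrec.succ.comp (Primrec.snd.comp Primrec.snd)
  exact this.comp (Primrec.const ()) Primrec.id

theorem primrec_liftVar : Primrec₂ liftVar := by
  refine Primrec.ite (Primrec.eq.comp (Primrec.nat_mod.comp Primrec.snd (Primrec.const 2))
    (Primrec.const 0)) Primrec.snd (Primrec.ite (Primrec.nat_lt.comp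
      (Primrec.nat_div.comp Primrec.snd (Primrec.const 2)) Primrec.fst) Primrec.snd
      (Primrec.nat_add.comp Primrec.snd (Primrec.const 2)))

theorem primrec_pullCode : Primrec₂ pullCode := by
  have lift := primrec_formulaMapCode primrec_liftVar
  refine primrec_formulaRec lift ?_ ?_
  · have x : Primrec fun p : ℕ × (ℕ × ℕ) × (ℕ × ℕ) => p.2.1.1 :=
      Primrec.fst.comp (Primrec.fst.comp Primrec.snd)
    have y : Primrec fun p : ℕ × (ℕ × ℕ) × (ℕ × ℕ) => p.2.1.2 :=
      Primrec.snd.comp (Primrec.fst.comp Primrec.snd)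
    exact Primrec.ite (Primrec.eq.comp (primrec_numAllCode.comp x) (Primrec.const 0))
      (primrec_impCode.comp (lift.comp Primrec.fst x)
        (Primrec.snd.comp (Primrec.snd.comp Primrec.snd)))
      (primrec_impCode.comp (Primrec.fst.comp (Primrec.snd.comp Primrec.snd))
        (lift.comp Primrec.fst y))
  · exact Primrec.fst.comp Primrec.snd

theorem primrec_blockVarCode : Primrec₂ blockVarCode := by
  have h : Primrec fun q : (ℕ × ℕ) × ℕ => q.2 / 2 :=
    Primrec.nat_div.comp Primrec.snd (Primrec.const 2)
  have m : Primrec fun q : (ℕ × ℕ) × ℕ => q.1.2 := Primrec.snd.comp Primrec.fst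
  have odd : ∀ {k : (ℕ × ℕ) × ℕ → ℕ}, Primrec k → Primrec fun q => 2 * k q + 1 := fun hk =>
    Primrec.succ.comp (Primrec.nat_mul.comp (Primrec.const 2) hk)
  exact Primrec.ite (Primrec.eq.comp (Primrec.nat_mod.comp Primrec.snd (Primrec.const 2))
    (Primrec.const 0))
    (odd (Primrec.nat_min.comp (Primrec₂.natPair.comp (Primrec.fst.comp Primrec.fst) h) m))
    (odd (Primrec.nat_add.comp (Primrec.succ.comp m) h))

theorem primrec_predArgCode : Primrec predArgCode :=
  Primrec.list_headI.comp ((Primrec.ofNat (List ℕ)).comp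
    (primrec_unpair_snd (primrec_unpair_snd Primrec.id)))

theorem primrec_predAtomsCode : Primrec predAtomsCode := by
  have : Primrec₂ fun (_ : Unit) (c : ℕ) => predAtomsCode c := by
    refine primrec_formulaRec ?_ ?_ ?_
    · have c2 : Primrec fun p : Unit × ℕ => p.2 := Primrec.snd
      have r := primrec_unpair_fst (primrec_unpair_snd c2)
      exact Primrec.ite (Primrec.eq.comp (primrec_unpair_fst c2) (Primrec.const 2))
        (Primrec.ite (Primrec.eq.comp (Primrec.nat_mod.comp r (Primrec.const 2)) (Primrec.const 1))
          (Primrec.list_cons.comp ((Primrec.nat_div.comp r (Primrec.const 2)).pair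
            (primrec_predArgCode.comp c2)) (Primrec.const []))
          (Primrec.const [])) (Primrec.const [])
    · exact Primrec.list_append.comp (Primrec.fst.comp (Primrec.snd.comp Primrec.snd))
        (Primrec.snd.comp (Primrec.snd.comp Primrec.snd))
    · exact Primrec.const []
  exact this.comp (Primrec.const ()) Primrec.id

theorem primrec_memFormulaCode :
    Primrec fun p : List (ℕ × ℕ) × ℕ × ℕ => memFormulaCode p.1 p.2.1 p.2.2 := by
  refine primrec_impsCode.comp (Primrec.list_map Primrec.fst ?_) (Primrec.const _)
  refine primrec_impCode.comp (Primrec.ite (Primrec.eq.comp (Primrec.fst.comp Primrec.snd)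
    (Primrec.fst.comp (Primrec.snd.comp Primrec.fst))) (Primrec₂.natPair.comp (Primrec.const 1)
      (Primrec₂.natPair.comp (Primrec.snd.comp (Primrec.snd.comp Primrec.fst))
        (Primrec.snd.comp Primrec.snd))) (Primrec.const _)) (Primrec.const _)

theorem primrec_elimPredCode : Primrec₂ elimPredCode := by
  refine primrec_formulaRec ?_ ?_ ?_
  · have c2 : Primrec fun p : List (ℕ × ℕ) × ℕ => p.2 := Primrec.snd
    have r := primrec_unpair_fst (primrec_unpair_snd c2)
    have r2 := Primrec.nat_div.comp r (Primrec.const 2)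
    exact Primrec.ite (Primrec.eq.comp (primrec_unpair_fst c2) (Primrec.const 2))
      (Primrec.ite (Primrec.eq.comp (Primrec.nat_mod.comp r (Primrec.const 2)) (Primrec.const 1))
        (primrec_memFormulaCode.comp (Primrec.fst.pair (r2.pair (primrec_predArgCode.comp c2))))
        (Primrec₂.natPair.comp (Primrec.const 2) (Primrec₂.natPair.comp r2
          (primrec_unpair_snd (primrec_unpair_snd c2))))) c2
  · exact primrec_impCode.comp (Primrec.fst.comp (Primrec.snd.comp Primrec.snd))
      (Primrec.snd.comp (Primrec.snd.comp Primrec.snd))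
  · exact Primrec.const _

theorem primrec_refutationCode {e m : ρ → ℕ} {l : ρ → List (ℕ × ℕ)} (he : Primrec e)
    (hl : Primrec l) (hm : Primrec m) : Primrec fun a => refutationCode (e a) (l a) (m a) := by
  have map := primrec_formulaMapCode primrec_blockVarCode
  refine primrec_impsCode.comp (Primrec.list_cons.comp
    (map.comp ((Primrec.const 0).pair hm) he) (Primrec.list_map hl ?_)) (Primrec.const _)
  exact map.comp ((Primrec.fst.comp Primrec.snd).pair (hm.comp Primrec.fst))
    (primrec_unpair_snd (primrec_unpair_snd (Primrec.snd.comp Primrec.snd)))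

theorem primrec_allsCode : Primrec₂ allsCode :=
  Primrec.nat_iterate Primrec.fst Primrec.snd (Primrec₂.natPair.comp (Primrec.const 4) Primrec.snd)

theorem primrec_sublists' {σ : Type*} [Primcodable σ] :
    Primrec (List.sublists' : List σ → List (List σ)) := by
  have : Primrec fun l : List σ =>
      l.foldr (fun a r => r ++ r.map (List.cons a)) [([] : List σ)] := by
    refine Primrec.list_foldr Primrec.id (Primrec.const [([] : List σ)])
      (h := fun _ p => p.2 ++ p.2.map (List.cons p.1)) ?_
    refine Primrec.list_append.comp (Primrec.snd.comp Primrec.snd)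
      (Primrec.list_map (Primrec.snd.comp Primrec.snd) ?_)
    exact Primrec.list_cons.comp (Primrec.fst.comp (Primrec.snd.comp Primrec.fst)) Primrec.snd
  refine this.of_eq fun l => ?_
  induction l with
  | nil => rfl
  | cons a l ih => rw [List.foldr_cons, ih, List.sublists'_cons]

theorem primrec_ruleAxiomCode {u e m : ρ → ℕ} {l : ρ → List (ℕ × ℕ)} (hu : Primrec u)
    (he : Primrec e) (hl : Primrec l) (hm : Primrec m) :
    Primrec fun a => ruleAxiomCode (u a) (e a) (l a) (m a) := by
  have map := primrec_formulaMapCode primrec_blockVarCode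
  have ref := primrec_refutationCode he hl hm
  refine primrec_allsCode.comp (Primrec.succ.comp hm) (primrec_impsCode.comp
    (Primrec.list_cons.comp (map.comp ((Primrec.const 0).pair hm) hu)
      (Primrec.list_append.comp (Primrec.list_map hl ?_)
        (Primrec.list_map (primrec_sublists'.comp (primrec_predAtomsCode.comp ref)) ?_)))
    (Primrec.const _))
  · exact map.comp ((Primrec.fst.comp Primrec.snd).pair (hm.comp Primrec.fst))
      (primrec_unpair_fst (primrec_unpair_snd (Primrec.snd.comp Primrec.snd)))
  · exact primrec_elimPredCode.comp Primrec.snd (ref.comp Primrec.fst)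

end Codes

/-! ### Agreement of the operations on formulas and on codes -/

section CodeCorrectness

theorem encode_relation_inl {L : FirstOrder.Language.{u, v}} [Encodable (Σ n, L.Relations n)]
    {K l : ℕ} (R : L.Relations l) :
    Encodable.encode (⟨l, Sum.inl R⟩ : Σ n, (plusLang L K).Relations n) =
      2 * Encodable.encode (⟨l, R⟩ : Σ n, L.Relations n) := rfl

theorem encode_relation_inr {L : FirstOrder.Language.{u, v}} [Encodable (Σ n, L.Relations n)]
    {K : ℕ} (k : Fin K) :
    Encodable.encode (⟨1, Sum.inr (PredSymbol.C k)⟩ : Σ n, (plusLang L K).Relations n) =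
      2 * (k : ℕ) + 1 := rfl

variable {L : FirstOrder.Language.{u, v}} [Encodable (Σ n, L.Functions n)] {α β : Type}
  [Encodable α] [Encodable β]

theorem termCode_relabel {f : ℕ → ℕ} {g : α → β}
    (hg : ∀ a, Encodable.encode (g a) = f (Encodable.encode a)) (t : L.Term α) :
    termCode (t.relabel g) = termMapCode f (termCode t) := by
  induction t with
  | var a => rw [Term.relabel, termCode, termCode, termMapCode_var, hg]
  | func F ts ih =>
    rw [Term.relabel, termCode, termCode, termMapCode_func, List.map_ofFn]
    simp only [ih, Function.comp_def]

theorem termCode_relabel_of_encode_eq {g : α → β}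
    (hg : ∀ a, Encodable.encode (g a) = Encodable.encode a) (t : L.Term α) :
    termCode (t.relabel g) = termCode t := by
  induction t with
  | var a => rw [Term.relabel, termCode, termCode, hg]
  | func F ts ih =>
    rw [Term.relabel, termCode, termCode]
    simp only [ih]

variable {K : ℕ}

theorem termCode_lowerTerm (t : (plusLang L K).Term α) :
    termCode (lowerTerm t) = termCode t := by
  induction t with
  | var a => rfl
  | func f ts ih =>
    cases f with
    | inl f => simp only [lowerTerm, termCode, ih]; rfl
    | inr e => exact nomatch e

variable [Encodable (Σ n, L.Relations n)]

theorem formulaCode_castLE {m n : ℕ} (h : m ≤ n) (φ : L.BoundedFormula α m) :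
    formulaCode (φ.castLE h) = formulaCode φ := by
  have key : ∀ {m n : ℕ} (h : m ≤ n) (t : L.Term (α ⊕ Fin m)),
      termCode (t.relabel (Sum.map id (Fin.castLE h))) = termCode t := fun h t =>
    termCode_relabel_of_encode_eq (by rintro (a | i) <;> rfl) t
  induction φ generalizing n with
  | falsum => rfl
  | equal t₁ t₂ => simp only [BoundedFormula.castLE, formulaCode, key]
  | rel R ts => simp only [BoundedFormula.castLE, formulaCode, Function.comp_apply, key]
  | imp _ _ ih1 ih2 => simp only [BoundedFormula.castLE, formulaCode, ih1, ih2]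
  | all _ ih => simp only [BoundedFormula.castLE, formulaCode, ih]

theorem formulaCode_mapTermRel {f g : ℕ → ℕ}
    (ft : ∀ n, L.Term (α ⊕ (Fin n)) → L.Term (β ⊕ (Fin (g n))))
    (hft : ∀ n t, termCode (ft n t) = termMapCode f (termCode t))
    (h : ∀ n, L.BoundedFormula β (g (n + 1)) → L.BoundedFormula β (g n + 1))
    (hh : ∀ n φ, formulaCode (h n φ) = formulaCode φ) {n : ℕ} (φ : L.BoundedFormula α n) :
    formulaCode (φ.mapTermRel ft (fun _ => id) h) = formulaMapCode f (formulaCode φ) := by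
  induction φ with
  | falsum =>
    rw [BoundedFormula.mapTermRel, formulaCode, formulaCode, formulaMapCode,
      formulaRec_atom _ _ _ (by norm_num)]
    simp [atomMapCode]
  | equal t₁ t₂ =>
    rw [BoundedFormula.mapTermRel, formulaCode, formulaCode, formulaMapCode,
      formulaRec_atom _ _ _ (by norm_num)]
    simp [atomMapCode, hft]
  | rel R ts =>
    rw [BoundedFormula.mapTermRel, formulaCode, formulaCode, formulaMapCode,
      formulaRec_atom _ _ _ (by norm_num)]
    simp [atomMapCode, hft, Function.comp_def]
  | imp _ _ ih1 ih2 =>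
    rw [BoundedFormula.mapTermRel, formulaCode, formulaCode, formulaMapCode, formulaRec_imp,
      ih1, ih2]
    rfl
  | all _ ih =>
    rw [BoundedFormula.mapTermRel, formulaCode, formulaCode, formulaMapCode, formulaRec_all, hh,
      ih]
    rfl

theorem formulaCode_liftAt {n : ℕ} (m : ℕ) (φ : L.BoundedFormula α n) :
    formulaCode (φ.liftAt 1 m) = formulaMapCode (liftVar m) (formulaCode φ) := by
  refine formulaCode_mapTermRel _ (fun k t => ?_) _ (fun _ _ => formulaCode_castLE _ _) φ
  refine termCode_relabel ?_ t
  rintro (a | i)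
  · simp [liftVar]
  · have h1 : (2 * (i : ℕ) + 1) % 2 ≠ 0 := by omega
    have h2 : (2 * (i : ℕ) + 1) / 2 = i := by omega
    have e : ∀ {k : ℕ} (i : Fin k), Encodable.encode i = (i : ℕ) := fun _ => rfl
    simp only [Sum.map_inr, Encodable.encode_inr, liftVar, e, h1, h2, if_false]
    split_ifs
    · simp
    · simp only [Fin.val_addNat]; ring

theorem formulaCode_toBlock {N : ℕ} (j m : ℕ) (φ : L.Formula (Fin N)) :
    formulaCode (toBlock j m φ) = formulaMapCode (blockVarCode (j, m)) (formulaCode φ) := by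
  refine formulaCode_mapTermRel _ (fun k t => ?_) _ (fun _ _ => formulaCode_castLE _ _) φ
  refine termCode_relabel ?_ t
  have e : ∀ {k : ℕ} (i : Fin k), Encodable.encode i = (i : ℕ) := fun _ => rfl
  rintro (a | i)
  · simp [BoundedFormula.relabelAux, blockVar, blockVarCode, e]
  · have h1 : (2 * (i : ℕ) + 1) % 2 ≠ 0 := by omega
    have h2 : (2 * (i : ℕ) + 1) / 2 = i := by omega
    simp [BoundedFormula.relabelAux, blockVarCode, e, h2]

theorem numAllCode_formulaCode {n : ℕ} (φ : L.BoundedFormula α n) :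
    numAllCode (formulaCode φ) = numAll φ := by
  induction φ with
  | falsum => rw [formulaCode, numAllCode, formulaRec_atom _ _ _ (by norm_num), numAll]
  | equal => rw [formulaCode, numAllCode, formulaRec_atom _ _ _ (by norm_num), numAll]
  | rel => rw [formulaCode, numAllCode, formulaRec_atom _ _ _ (by norm_num), numAll]
  | imp _ _ ih1 ih2 => rw [formulaCode, numAllCode, formulaRec_imp, numAll, ← ih1, ← ih2]; rfl
  | all _ ih => rw [formulaCode, numAllCode, formulaRec_all, numAll, ← ih]; rfl

theorem formulaCode_pull {n : ℕ} (φ : L.BoundedFormula α n) :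
    formulaCode (pull φ) = pullCode n (formulaCode φ) := by
  induction φ with
  | falsum =>
    rw [pull, formulaCode_liftAt, formulaCode, pullCode, formulaRec_atom _ _ _ (by norm_num)]
  | equal =>
    rw [pull, formulaCode_liftAt, formulaCode, pullCode, formulaRec_atom _ _ _ (by norm_num)]
  | rel =>
    rw [pull, formulaCode_liftAt, formulaCode, pullCode, formulaRec_atom _ _ _ (by norm_num)]
  | imp φ ψ ih1 ih2 =>
    rw [pull, formulaCode.eq_4, pullCode, formulaRec_imp]
    rw [pullCode] at ih1 ih2
    simp only [numAllCode_formulaCode, ← formulaCode_liftAt, ← ih1, ← ih2]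
    split_ifs <;> rfl
  | all _ _ => rw [pull, formulaCode.eq_5, pullCode, formulaRec_all]

theorem formulaCode_imps {n : ℕ} (l : List (L.BoundedFormula α n)) (ψ : L.BoundedFormula α n) :
    formulaCode (imps l ψ) = impsCode (l.map formulaCode) (formulaCode ψ) := by
  induction l with
  | nil => rfl
  | cons φ l ih =>
    change formulaCode (φ.imp (imps l ψ)) = impCode _ (impsCode _ _)
    rw [formulaCode, ih]; rfl

theorem formulaCode_alls {n : ℕ} (φ : L.BoundedFormula α n) :
    formulaCode (φ.alls : L.Formula α) = allsCode n (formulaCode φ) := by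
  induction n with
  | zero => rfl
  | succ n ih => rw [BoundedFormula.alls, ih, formulaCode]; rfl

/-- The code of an entry of `predAtoms φ`. -/
def atomCode {n : ℕ} (p : Fin K × L.Term (α ⊕ Fin n)) : ℕ × ℕ := (p.1, termCode p.2)

theorem predArgCode_pair (r : ℕ) (f : Fin 1 → ℕ) :
    predArgCode (Nat.pair 2 (Nat.pair r (Encodable.encode (List.ofFn f)))) = f 0 := by
  simp [predArgCode]

theorem predAtomsCode_formulaCode {n : ℕ} (φ : (plusLang L K).BoundedFormula α n) :
    predAtomsCode (formulaCode φ) = (predAtoms φ).map atomCode := by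
  induction φ with
  | falsum =>
    rw [formulaCode, predAtomsCode, formulaRec_atom _ _ _ (by norm_num)]; simp [predAtoms]
  | equal =>
    rw [formulaCode, predAtomsCode, formulaRec_atom _ _ _ (by norm_num)]; simp [predAtoms]
  | rel R ts =>
    rw [formulaCode, predAtomsCode, formulaRec_atom _ _ _ (by norm_num)]
    rcases R with R | R
    · simp [predAtoms, encode_relation_inl]
    · cases R with
      | C k =>
      simp only [Nat.unpair_pair, predArgCode_pair, encode_relation_inr, predAtoms, if_true,
        List.map_cons, List.map_nil, atomCode, termCode_lowerTerm]
      rw [if_pos (by omega), show (2 * (k : ℕ) + 1) / 2 = k by omega]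
  | imp _ _ ih1 ih2 =>
    rw [formulaCode, predAtomsCode, formulaRec_imp, predAtoms, List.map_append, ← ih1, ← ih2]
    rfl
  | all _ _ => rw [formulaCode, predAtomsCode, formulaRec_all]; rfl

theorem formulaCode_memFormula {n : ℕ} (P : List (Fin K × L.Term (α ⊕ Fin n))) (k : Fin K)
    (t : L.Term (α ⊕ Fin n)) :
    formulaCode (memFormula P k t) = memFormulaCode (P.map atomCode) k (termCode t) := by
  rw [memFormula, formulaCode_imps, memFormulaCode, List.map_map, List.map_map]
  refine congrArg₂ impsCode (List.map_congr_left fun p _ => ?_) rfl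
  simp only [Function.comp_apply, atomCode, Fin.val_inj]
  split_ifs <;> rfl

theorem formulaCode_elimPred {n : ℕ} (P : List (Fin K × L.Term (α ⊕ Fin n)))
    (φ : (plusLang L K).BoundedFormula α n) :
    formulaCode (elimPred P φ) = elimPredCode (P.map atomCode) (formulaCode φ) := by
  induction φ with
  | falsum =>
    rw [formulaCode, elimPredCode, formulaRec_atom _ _ _ (by norm_num)]; simp [elimPred, formulaCode]
  | equal =>
    rw [formulaCode, elimPredCode, formulaRec_atom _ _ _ (by norm_num)]
    simp [elimPred, formulaCode, termCode_lowerTerm]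
  | rel R ts =>
    rw [formulaCode, elimPredCode, formulaRec_atom _ _ _ (by norm_num)]
    rcases R with R | R
    · simp [elimPred, encode_relation_inl, formulaCode, termCode_lowerTerm]
    · cases R with
      | C k =>
      simp only [Nat.unpair_pair, predArgCode_pair, encode_relation_inr, elimPred, if_true,
        formulaCode_memFormula, termCode_lowerTerm]
      rw [if_pos (by omega), show (2 * (k : ℕ) + 1) / 2 = k by omega]
  | imp _ _ ih1 ih2 =>
    rw [elimPred, formulaCode, formulaCode, elimPredCode, formulaRec_imp, ih1, ih2]; rfl
  | all _ _ => rw [formulaCode, elimPredCode, formulaRec_all]; rfl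

/-- The code of a clause along with the number of the tuple to which it is applied. -/
def numberedClauseCode (p : ℕ × ClosureClause L K) : ℕ × ℕ := (p.1, p.2.code)

theorem formulaCode_refutation {N : ℕ} (η : (plusLang L K).Formula (Fin N))
    (cl : List (ℕ × ClosureClause L K)) (m : ℕ) :
    formulaCode (refutation η cl m) =
      refutationCode (formulaCode η) (cl.map numberedClauseCode) m := by
  rw [refutation, formulaCode_imps, refutationCode, List.map_cons, List.map_map, List.map_map,
    formulaCode_toBlock]
  refine congrArg₂ impsCode (congrArg _ (List.map_congr_left fun p _ => ?_)) rfl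
  simp [formulaCode_toBlock, numberedClauseCode, ClosureClause.code]

theorem formulaCode_ruleAxiom {N : ℕ} (μ : L.Formula (Fin N)) (η : (plusLang L K).Formula (Fin N))
    (cl : List (ℕ × ClosureClause L K)) (m : ℕ) :
    formulaCode (ruleAxiom μ η cl m) =
      ruleAxiomCode (formulaCode μ) (formulaCode η) (cl.map numberedClauseCode) m := by
  rw [ruleAxiom, formulaCode_alls, formulaCode_imps, ruleAxiomCode, List.map_cons,
    List.map_append, ← formulaCode_refutation, predAtomsCode_formulaCode, List.sublists'_map,
    List.map_map, List.map_map, List.map_map, List.map_map, formulaCode_toBlock]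
  refine congrArg _ (congrArg₂ impsCode (congrArg _ (congrArg₂ _
    (List.map_congr_left fun p _ => ?_) (List.map_congr_left fun P _ => ?_))) rfl)
  · simp [formulaCode_toBlock, numberedClauseCode, ClosureClause.code]
  · exact formulaCode_elimPred P _

end CodeCorrectness

/-! ### Enumeration of the axioms -/

section Enumeration

/-- A recursively enumerable relation has sections that are enumerated uniformly by a primitive
recursive function, where `none` stands for a stage at which nothing is listed. -/
theorem exists_primrec_enumeration {p : ℕ × ℕ → Prop} (hp : REPred p) :
    ∃ h : ℕ → ℕ → Option ℕ, Primrec₂ h ∧ ∀ n c, p (n, c) ↔ ∃ w, h n w = some c := by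
  obtain ⟨c, hc⟩ := Nat.Partrec.Code.exists_code.1 hp
  refine ⟨fun n w => (Nat.Partrec.Code.evaln w.unpair.2 c (Nat.pair n w.unpair.1)).map
    fun _ => w.unpair.1, ?_, fun n d => ?_⟩
  · have w : Primrec fun q : ℕ × ℕ => q.2 := Primrec.snd
    have arg : Primrec fun q : ℕ × ℕ =>
        ((q.2.unpair.2, c), Nat.pair q.1 q.2.unpair.1) :=
      ((primrec_unpair_snd w).pair (Primrec.const c)).pair
        (Primrec₂.natPair.comp Primrec.fst (primrec_unpair_fst w))
    exact Primrec.option_map (Nat.Partrec.Code.primrec_evaln.comp arg)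
      ((primrec_unpair_fst w).comp Primrec.fst)
  · have dom : p (n, d) ↔ ∃ y, y ∈ Nat.Partrec.Code.eval c (Nat.pair n d) := by
      rw [hc]
      simp
    rw [dom]
    constructor
    · rintro ⟨y, hy⟩
      obtain ⟨k, hk⟩ := Nat.Partrec.Code.evaln_complete.1 hy
      refine ⟨Nat.pair d k, ?_⟩
      simp only [Nat.unpair_pair]
      rw [Option.mem_def.1 hk]
      rfl
    · rintro ⟨w, hw⟩
      obtain ⟨y, hy, rfl⟩ := Option.map_eq_some_iff.1 hw
      exact ⟨y, Nat.Partrec.Code.evaln_complete.2 ⟨_, hy⟩⟩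

variable {L : FirstOrder.Language.{u, v}} [Encodable (Σ n, L.Functions n)]
  [Encodable (Σ n, L.Relations n)]

/-- The axiom for the separation rule with the given head, a list of codes of clauses and a bound on
the variables, in terms of codes. -/
noncomputable def schemeCode (head : ℕ) (l : List (ℕ × ℕ)) (m : ℕ) : ℕ :=
  if head.unpair.1 = 0 then head.unpair.2
  else ruleAxiomCode head.unpair.2.unpair.2.unpair.2.unpair.1
    head.unpair.2.unpair.2.unpair.2.unpair.2 l m

theorem primrec_schemeCode :
    Primrec fun p : ℕ × List (ℕ × ℕ) × ℕ => schemeCode p.1 p.2.1 p.2.2 := by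
  have h : Primrec fun p : ℕ × List (ℕ × ℕ) × ℕ => p.1 := Primrec.fst
  have body := primrec_unpair_snd (primrec_unpair_snd (primrec_unpair_snd h))
  exact Primrec.ite (Primrec.eq.comp (primrec_unpair_fst h) (Primrec.const 0))
    (primrec_unpair_snd h) (primrec_ruleAxiomCode (primrec_unpair_fst body)
      (primrec_unpair_snd body) (Primrec.fst.comp Primrec.snd) (Primrec.snd.comp Primrec.snd))

theorem schemeCode_zero (φ : L.Sentence) (l : List (ℕ × ℕ)) (m : ℕ) :
    schemeCode (SeparationRule.zero φ).headCode l m = formulaCode φ := by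
  simp [schemeCode, SeparationRule.headCode]

theorem schemeCode_pos {N K : ℕ} (hK : 1 ≤ K) (μ : L.Formula (Fin N))
    {η : (plusLang L K).Formula (Fin N)} (hη : BoundedFormula.IsQF η)
    (τ : Set (ClosureClause L K)) (cl : List (ℕ × ClosureClause L K)) (m : ℕ) :
    schemeCode (SeparationRule.pos N K hK μ η hη τ).headCode (cl.map numberedClauseCode) m =
      formulaCode (ruleAxiom μ η cl m) := by
  simp [schemeCode, SeparationRule.headCode, formulaCode_ruleAxiom]

/-- Codes that belong to clauses in `τ` can be lifted to clauses in `τ`. -/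
theorem exists_map_numberedClauseCode {K : ℕ} {τ : Set (ClosureClause L K)} {l : List (ℕ × ℕ)}
    (hl : ∀ p ∈ l, p.2 ∈ ClosureClause.code '' τ) :
    ∃ cl : List (ℕ × ClosureClause L K), (∀ p ∈ cl, p.2 ∈ τ) ∧ cl.map numberedClauseCode = l := by
  induction l with
  | nil => exact ⟨[], by simp, rfl⟩
  | cons p l ih =>
    obtain ⟨cl, h1, h2⟩ := ih fun p hp => hl p (by simp [hp])
    obtain ⟨c, hc, hcp⟩ := hl p (by simp)
    refine ⟨(p.1, c) :: cl, ?_, ?_⟩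
    · simpa using ⟨hc, fun a b => h1 (a, b)⟩
    · rw [List.map_cons, h2, numberedClauseCode, hcp]

theorem exists_filterMap_eq {h : ℕ → Option ℕ} {l : List (ℕ × ℕ)}
    (hl : ∀ p ∈ l, ∃ w, h w = some p.2) :
    ∃ ws : List (ℕ × ℕ), (ws.filterMap fun w => (h w.2).map (Prod.mk w.1)) = l := by
  induction l with
  | nil => exact ⟨[], rfl⟩
  | cons p l ih =>
    obtain ⟨ws, hws⟩ := ih fun p hp => hl p (by simp [hp])
    obtain ⟨w, hw⟩ := hl p (by simp)
    exact ⟨(p.1, w) :: ws, by simp [hw, hws]⟩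

/-- The first-order axioms for an essentially recursively enumerable scheme can be listed
effectively. -/
theorem exists_enumeration_schemeTheory {S : Set (SeparationRule L)} (hS : EssentiallyRE S) :
    ∃ Φ : ℕ → L.Sentence, Set.range Φ = (SchemeTheory S : L.Theory) ∧
      Computable fun n => formulaCode (Φ n) := by
  obtain ⟨σ, rfl, hhead, hcl⟩ := hS
  obtain ⟨h, hh, hmem⟩ := exists_primrec_enumeration hcl
  let listed : ℕ → List (ℕ × ℕ) → List (ℕ × ℕ) := fun n ws =>
    ws.filterMap fun w => (h n w.2).map (Prod.mk w.1)
  let e : ℕ × List (ℕ × ℕ) × ℕ → ℕ := fun t =>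
    schemeCode (σ t.1).headCode (listed t.1 t.2.1) t.2.2
  have he : Computable e := by
    have hl : Primrec fun t : ℕ × List (ℕ × ℕ) × ℕ => listed t.1 t.2.1 := by
      refine Primrec.listFilterMap (Primrec.fst.comp Primrec.snd) ?_
      refine Primrec.option_map (hh.comp (Primrec.fst.comp Primrec.fst)
        (Primrec.snd.comp Primrec.snd)) ?_
      exact (Primrec.fst.comp (Primrec.snd.comp Primrec.fst)).pair Primrec.snd
    exact primrec_schemeCode.to_comp.comp ((hhead.comp Computable.fst).pair
      (hl.to_comp.pair (Computable.snd.comp Computable.snd)))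
  have hlisted : ∀ n ws, ∀ p ∈ listed n ws, p.2 ∈ (σ n).clauseCodes := by
    intro n ws p hp
    obtain ⟨w, -, hw⟩ := List.mem_filterMap.1 hp
    obtain ⟨c, hc, rfl⟩ := Option.map_eq_some_iff.1 hw
    exact (hmem n c).2 ⟨_, hc⟩
  -- Every number in the list is the code of an axiom.
  have hsound : ∀ t, ∃ φ ∈ (SchemeTheory (Set.range σ) : L.Theory), formulaCode φ = e t := by
    rintro ⟨n, ws, m⟩
    have hn : σ n ∈ Set.range σ := ⟨n, rfl⟩
    have hl := hlisted n ws
    dsimp only [e]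
    generalize listed n ws = l at hl
    generalize σ n = s at hn hl
    rcases s with φ | ⟨N, K, hK, μ, η, hη, τ⟩
    · exact ⟨φ, .zero hn, (schemeCode_zero φ _ _).symm⟩
    · obtain ⟨cl, hcl, rfl⟩ := exists_map_numberedClauseCode hl
      exact ⟨_, .pos hn cl hcl m, (schemeCode_pos hK μ hη τ cl m).symm⟩
  -- Every axiom is listed.
  have hcomplete : ∀ φ ∈ (SchemeTheory (Set.range σ) : L.Theory), ∃ t, formulaCode φ = e t := by
    rintro _ (⟨n, hn⟩ | ⟨⟨n, hn⟩, cl, hcl, m⟩)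
    · exact ⟨(n, [], 0), by dsimp only [e]; rw [hn, schemeCode_zero]⟩
    · obtain ⟨ws, hws⟩ := exists_filterMap_eq (h := h n) (l := cl.map numberedClauseCode) (by
        intro p hp
        obtain ⟨q, hq, rfl⟩ := List.mem_map.1 hp
        refine (hmem n _).1 ?_
        change _ ∈ (σ n).clauseCodes
        rw [hn]
        exact ⟨q.2, hcl q hq, rfl⟩)
      refine ⟨(n, ws, m), ?_⟩
      dsimp only [e, listed]
      rw [hws, hn, schemeCode_pos]
  choose Φ hΦ hcode using hsound
  refine ⟨fun n => Φ (Denumerable.ofNat _ n), ?_, ?_⟩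
  · ext φ
    constructor
    · rintro ⟨n, rfl⟩
      exact hΦ _
    · intro hφ
      obtain ⟨t, ht⟩ := hcomplete φ hφ
      refine ⟨Encodable.encode t, formulaCode_injective ?_⟩
      dsimp only
      rw [Denumerable.ofNat_encode, hcode, ht]
  · simp only [hcode]
    exact he.comp (Computable.ofNat _)

end Enumeration

/-! ### Recursive axiomatisations -/

section Craig

variable {L : FirstOrder.Language.{u, v}}

/-- The sentence `⊤ → (⊤ → … → φ)`, with `n` premises. -/
def padded (φ : L.Sentence) (n : ℕ) : L.Sentence :=
  imps (List.replicate n ⊤) φ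

theorem models_padded {A : Type w} [L.Structure A] (φ : L.Sentence) (n : ℕ) :
    A ⊨ padded φ n ↔ A ⊨ φ := by
  rw [padded, Sentence.Realize, Formula.Realize, realize_imps]
  refine ⟨fun h => h fun ψ hψ => ?_, fun h _ => h⟩
  rw [List.eq_of_mem_replicate hψ]
  exact BoundedFormula.realize_top.2 trivial

variable [Encodable (Σ n, L.Functions n)] [Encodable (Σ n, L.Relations n)]

/-- The range of a computable function `f` with `n ≤ f n` is decidable, because only finitely many
arguments have to be checked. -/
theorem computablePred_mem_range {f : ℕ → ℕ} (hf : Computable f) (hle : ∀ n, n ≤ f n) :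
    ComputablePred fun m => ∃ n, f n = m := by
  let B : ℕ → ℕ → Bool := fun m k => Nat.rec false (fun i r => r || (f i == m)) k
  have hB : ∀ m k, B m k = true ↔ ∃ i < k, f i = m := by
    intro m k
    induction k with
    | zero => simp [B]
    | succ k ih =>
      change (B m k || (f k == m)) = true ↔ _
      rw [Bool.or_eq_true, ih, beq_iff_eq]
      constructor
      · rintro (⟨i, hi, h⟩ | h)
        · exact ⟨i, by omega, h⟩
        · exact ⟨k, by omega, h⟩
      · rintro ⟨i, hi, h⟩
        rcases Nat.lt_succ_iff_lt_or_eq.1 hi with hi | rfl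
        · exact Or.inl ⟨i, hi, h⟩
        · exact Or.inr h
  have comp : Computable fun m => B m (m + 1) := by
    refine Computable.nat_rec (h := fun m p => p.2 || (f p.1 == m)) Computable.succ (Computable.const false) ?_
    refine Primrec.or.to_comp.comp (Computable.snd.comp Computable.snd) ?_
    exact (Primrec.beq (α := ℕ)).to_comp.comp
      (hf.comp (Computable.fst.comp Computable.snd)) Computable.fst
  refine ComputablePred.computable_iff.2 ⟨_, comp, funext fun m => propext ?_⟩
  refine Iff.trans ?_ (hB m (m + 1)).symm
  exact ⟨fun ⟨n, hn⟩ => ⟨n, Nat.lt_succ_of_le (hn ▸ hle n), hn⟩, fun ⟨n, _, hn⟩ => ⟨n, hn⟩⟩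

theorem isRecursive_range {Φ : ℕ → L.Sentence} (hΦ : Computable fun n => formulaCode (Φ n))
    (hle : ∀ n, n ≤ formulaCode (Φ n)) : IsRecursive (Set.range Φ) :=
  (computablePred_mem_range hΦ hle).of_eq fun m => by simp

theorem formulaCode_padded (φ : L.Sentence) (n : ℕ) :
    formulaCode (padded φ n) = (impCode (impCode falsumCode falsumCode))^[n] (formulaCode φ) := by
  induction n with
  | zero => rfl
  | succ n ih =>
    rw [Function.iterate_succ_apply', ← ih]
    rfl

theorem le_iterate_of_lt {f : ℕ → ℕ} (hf : ∀ x, x < f x) (n x : ℕ) : n ≤ f^[n] x := by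
  induction n with
  | zero => exact Nat.zero_le _
  | succ n ih =>
    rw [Function.iterate_succ_apply']
    exact ih.trans_lt (hf _)

/-- Craig's trick: padding the `n`-th sentence of an effective list to a code of size at least `n`
makes the set of the listed sentences decidable. -/
theorem exists_isRecursive {Φ : ℕ → L.Sentence} (hΦ : Computable fun n => formulaCode (Φ n)) :
    ∃ T : L.Theory, IsRecursive T ∧
      ∀ (A : Type w) [L.Structure A], A ⊨ T ↔ A ⊨ (Set.range Φ : L.Theory) := by
  refine ⟨Set.range fun n => padded (Φ n) n, isRecursive_range ?_ fun n => ?_, fun A _ => ?_⟩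
  · simp only [formulaCode_padded]
    have : Primrec fun p : ℕ × ℕ =>
        (impCode (impCode falsumCode falsumCode))^[p.1] p.2 :=
      Primrec.nat_iterate Primrec.fst Primrec.snd
        (primrec_impCode.comp (Primrec.const _) Primrec.snd)
    exact this.to_comp.comp (Computable.id.pair hΦ)
  · rw [formulaCode_padded]
    exact le_iterate_of_lt (fun x => lt_pair_of_pos (by norm_num) (Nat.right_le_pair _ _)) _ _
  · simp [Theory.model_iff, models_padded]

theorem formulaCode_pullIter (φ : L.Sentence) (n : ℕ) :
    formulaCode (pullIter φ n) = Nat.rec (formulaCode φ) (fun k c => pullCode k c) n := by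
  induction n with
  | zero => rfl
  | succ n ih => rw [pullIter, formulaCode_pull, ih]

/-- A variant of Craig's trick for universal theories: here the padding consists of dummy
quantifiers, which arise when `pull` is applied more often than needed. -/
theorem exists_isRecursive_isUniversalTheory {Φ : ℕ → L.Sentence}
    (hΦ : Computable fun n => formulaCode (Φ n)) (hpol : ∀ n, HasPolarity true (Φ n)) :
    ∃ T : L.Theory, IsRecursive T ∧ IsUniversalTheory T ∧
      ∀ (A : Type w) [L.Structure A] [Nonempty A], A ⊨ T ↔ A ⊨ (Set.range Φ : L.Theory) := by
  refine ⟨Set.range fun n => (pullIter (Φ n) (n + numAll (Φ n))).alls,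
    isRecursive_range ?_ fun n => ?_, ?_, fun A _ _ => ?_⟩
  · simp only [formulaCode_alls, formulaCode_pullIter, ← numAllCode_formulaCode]
    have iter : Primrec fun p : ℕ × ℕ =>
        (Nat.rec p.2 (fun k c => pullCode k c) p.1 : ℕ) :=
      Primrec.nat_rec' (h := fun _ p => pullCode p.1 p.2) Primrec.fst Primrec.snd (primrec_pullCode.comp
        (Primrec.fst.comp Primrec.snd) (Primrec.snd.comp Primrec.snd))
    have len : Primrec fun p : ℕ × ℕ => p.1 + numAllCode p.2 :=
      Primrec.nat_add.comp Primrec.fst (primrec_numAllCode.comp Primrec.snd)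
    exact (primrec_allsCode.comp len (iter.comp (len.pair Primrec.snd))).to_comp.comp
      (Computable.id.pair hΦ)
  · rw [formulaCode_alls]
    exact (Nat.le_add_right _ _).trans
      (le_iterate_of_lt (fun x => lt_pair_of_pos (by norm_num) le_rfl) _ _)
  · rintro _ ⟨n, rfl⟩
    exact isUniversal_alls_pullIter (Nat.le_add_left _ _)
  · simp [Theory.model_iff, models_alls_pullIter (hpol _)]

end Craig

end Separation

theorem corollaryC {L : FirstOrder.Language.{u, v}} [Encodable (Σ n, L.Functions n)]
    [Encodable (Σ n, L.Relations n)]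
    (𝒜 ℬ : Separation.StructureClass.{u, v, w} L) (h𝒜 : Separation.IsElementary 𝒜)
    (S : Set (Separation.SeparationRule L)) (hS : Separation.EssentiallyRE S)
    (hℬ : Separation.IsSeparationSubclass S ℬ 𝒜) :
    (∃ T : L.Theory, Separation.IsRecursive T ∧ Separation.AxiomatisesRel T ℬ 𝒜) ∧
    ((∀ σ ∈ S, σ.MeetsUniversalCondition) →
      ∃ T : L.Theory, Separation.IsRecursive T ∧ Separation.IsUniversalTheory T ∧
        Separation.AxiomatisesRel T ℬ 𝒜) := by
  obtain ⟨Φ, hrange, hΦ⟩ := Separation.exists_enumeration_schemeTheory hS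
  have hax : ∀ T : L.Theory,
      (∀ (A : Type w) [L.Structure A] [Nonempty A], A ⊨ T ↔ A ⊨ (Set.range Φ : L.Theory)) →
      Separation.AxiomatisesRel T ℬ 𝒜 := by
    intro T hT
    rw [Separation.AxiomatisesRel, hℬ]
    ext A
    refine and_congr_right fun _ => ?_
    rw [hT, hrange, Separation.models_schemeTheory]
  constructor
  · obtain ⟨T, hrec, hT⟩ := Separation.exists_isRecursive.{u, v, w} hΦ
    exact ⟨T, hrec, hax T fun A _ _ => hT A⟩
  · intro hU
    obtain ⟨T, hrec, huniv, hT⟩ := Separation.exists_isRecursive_isUniversalTheory.{u, v, w} hΦ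
      fun n => Separation.hasPolarity_of_mem_schemeTheory hU (hrange ▸ Set.mem_range_self n)
    exact ⟨T, hrec, huniv, hax T hT⟩
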